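/- **Theorem 7.4 (highest smoothness).** Let $I=[0,1]$. A degree of smoothness $r$ is one of $k+\gamma$ ($k\ge 1$ an integer, $0<\gamma\le 1$: the $k$-th derivative exists and is $\gamma$-Hölder on $I$), $\infty$, or $\omega$ (real analytic on $I$). A *hyperbolic $\mathcal C^r$ Cantor set* $(C,S)$ is given by $\mathcal C^r$ maps $\varphi_0,\varphi_1:I\to I$ with $\varphi_0(0)=0$, $\varphi_1(1)=1$, $\varphi_0(1)<\varphi_1(0)$, such that $D\varphi_i>\alpha$ on $I$ for some $\alpha>0$, and such that for some $c>0$ and $0<\beta<1$ one has $D\varphi_w<c\,\beta^{|w|}$ on $I$ for all finite words $w$ in $0,1$, where $\varphi_{x_0\dots x_n}=\varphi_{x_0}\circ\dots\circ\varphi_{x_n}$ and $|w|$ is the length of $w$. Put $I_w=\varphi_w(I)$ and $C=\bigcap_n\bigcup_{|w|=n}I_w$; $S:I_0\cup I_1\to I$ is the map with inverse branches $\varphi_0,\varphi_1$, and $C$ is marked: the point of $\bigcap_n I_{x_0\dots x_n}$ has code $x_0x_1\dots$. Two such systems $(C,S)$, $(\widetilde C,\widetilde S)$ are *$\mathcal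 C^r$-conjugate* if there is an increasing bijection $\Phi:I\to I$, of class $\mathcal C^r$ together with its inverse, with $\widetilde S\circ\Phi=\Phi\circ S$ on $I_0\cup I_1$. Let $(C,S)$ be a hyperbolic $\mathcal C^{1+\gamma}$ Cantor set, $0<\gamma\le1$. For each $y=(\dots y_{-2}y_{-1})\in\Sigma^-=\prod_{-\infty}^{-1}\{0,1\}$ the limit (scaling function) $$R(y)=(R_l,R_g,R_r)(y)=\lim_{n\to\infty}\frac{\bigl(|I_{w_n0}|,|G_{w_n}|,|I_{w_n1}|\bigr)}{|I_{w_n}|},\qquad w_n=y_{-n}\dots y_{-1},$$ exists, where $G_w$ is the gap between $I_{w0}$ and $I_{w1}$. Let $C^y$ be the ratio Cantor set of $R$: it is $\bigcap_n\bigcup_{x_0,\dots,x_{n-1}} I^y_{x_0\dots x_{n-1}}$, where one starts from $[0,1]$ and $I^y_{x_0\dots x_{n-1}}$ is replaced by its subintervals $I^y_{x_0\dots x_{n-1}0}$, sharing its left endpoint, and $I^y_{x_0\dots x_{n-1}1}$, sharing its right endpoint, whose relative lengths are $R_l(\dots y_{-1}x_0\dots x_{n-1})$ and $R_r(\dots y_{-1}x_0\dots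 x_{n-1})$; it is marked by the nested intervals $I^y_{x_0\dots x_n}$. Then $C^y$ is the limit set at $y$: the sets $C\cap I_{w_n}$, affinely rescaled so as to have endpoints $0$ and $1$, converge to $C^y$ in the Hausdorff metric. These limit sets have the highest degree of smoothness of any hyperbolic Cantor set in the $\mathcal C^{1+\gamma}$-conjugacy class of $C$. That is, for every $y\in\Sigma^-$, every degree of smoothness $r$ (that is, $r=k+\gamma'$ with any $k\ge1$ and $0<\gamma'\le1$, $r=\infty$ or $r=\omega$) and every hyperbolic $\mathcal C^r$ Cantor set $(\widehat C,\widehat S)$ which is $\mathcal C^{1+\gamma}$-conjugate to $(C,S)$, there is a hyperbolic $\mathcal C^r$ Cantor set $(C^y,S^y)$ whose underlying set is the limit set $C^y$, with the same marking (so $S^y$ restricted to $C^y$ is the shift), and which is $\mathcal C^{1+\gamma}$-conjugate to $(C,S)$ and $\mathcal C^r$-conjugate to $(\widehat C,\widehat S)$. -/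

import Mathlib

open Set Filter Topology

namespace HyperbolicCantor

/-- The degrees of smoothness: `C^{k+γ}` with `k ≥ 1` and `0 < γ ≤ 1`, `C^∞` and `C^ω`. -/
inductive Degree : Type
  | holder (k : ℕ) (γ : ℝ) (hk : 1 ≤ k) (hγ₀ : 0 < γ) (hγ₁ : γ ≤ 1) : Degree
  | smooth : Degree
  | analytic : Degree

/-- `f` is of class `C^r` on `I = [0,1]` (one-sided derivatives at the endpoints). For `r = k+γ`
the `k`-th derivative exists and is Hölder continuous with exponent `γ`. For `r = ω`, around every
point of `I` the function `f` is on `I` the sum of a convergent power series. -/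
def IsOfClass : Degree → (ℝ → ℝ) → Prop
  | .holder k γ _ _ _, f =>
      ContDiffOn ℝ k f (Icc 0 1) ∧
        ∃ K : ℝ, ∀ s ∈ Icc (0 : ℝ) 1, ∀ t ∈ Icc (0 : ℝ) 1,
          |iteratedDerivWithin k f (Icc 0 1) s - iteratedDerivWithin k f (Icc 0 1) t|
            ≤ K * |s - t| ^ γ
  | .smooth, f => ContDiffOn ℝ ((⊤ : ℕ∞) : WithTop ℕ∞) f (Icc 0 1)
  | .analytic, f => AnalyticOn ℝ f (Icc 0 1)

/-- The composition `φ_{x₀} ∘ ⋯ ∘ φ_{xₙ}` attached to the word `x₀ … xₙ`. -/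
def wordMap (φ : Fin 2 → ℝ → ℝ) : List (Fin 2) → ℝ → ℝ
  | [] => id
  | i :: w => φ i ∘ wordMap φ w

/-- `φ₀, φ₁` (of which only the restrictions to `I = [0,1]` matter) are the two inverse branches
of the map `S : I₀ ∪ I₁ → I`, `I_i = φ_i(I)`, of a hyperbolic Cantor set of class `C^r`. -/
structure IsHyperbolic (r : Degree) (φ : Fin 2 → ℝ → ℝ) : Prop where
  mapsTo : ∀ i, MapsTo (φ i) (Icc 0 1) (Icc 0 1)
  isOfClass : ∀ i, IsOfClass r (φ i)
  left_end : φ 0 0 = 0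
  right_end : φ 1 1 = 1
  gap : φ 0 1 < φ 1 0
  deriv_lower : ∃ α : ℝ, 0 < α ∧
    ∀ i, ∀ t ∈ Icc (0 : ℝ) 1, α < derivWithin (φ i) (Icc 0 1) t
  deriv_upper : ∃ c β : ℝ, 0 < c ∧ 0 < β ∧ β < 1 ∧
    ∀ w : List (Fin 2), ∀ t ∈ Icc (0 : ℝ) 1,
      derivWithin (wordMap φ w) (Icc 0 1) t < c * β ^ w.length

/-- The word `x₀ … x_{n-1}` of the first `n` symbols of `x`. -/
def word (x : ℕ → Fin 2) (n : ℕ) : List (Fin 2) := (List.range n).map x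

/-- The interval `I_w = φ_w(I)`. -/
def interval (φ : Fin 2 → ℝ → ℝ) (w : List (Fin 2)) : Set ℝ := wordMap φ w '' Icc 0 1

/-- The Cantor set `C = ⋂ₙ ⋃ I_{x₀ … x_{n-1}}`. -/
def cantorSet (φ : Fin 2 → ℝ → ℝ) : Set ℝ :=
  ⋂ n : ℕ, ⋃ x : ℕ → Fin 2, interval φ (word x n)

/-- The two systems are `C^r` conjugate: there is an increasing bijection `Φ` of `I` which is
`C^r` together with its inverse `Ψ` and conjugates the expanding maps; in terms of the inverse
branches this reads `Φ ∘ φ_i = ψ_i ∘ Φ` on `I`. -/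
def IsConjugate (r : Degree) (φ ψ : Fin 2 → ℝ → ℝ) : Prop :=
  ∃ Φ Ψ : ℝ → ℝ,
    MapsTo Φ (Icc 0 1) (Icc 0 1) ∧ MapsTo Ψ (Icc 0 1) (Icc 0 1) ∧
    InvOn Ψ Φ (Icc 0 1) (Icc 0 1) ∧ StrictMonoOn Φ (Icc 0 1) ∧
    IsOfClass r Φ ∧ IsOfClass r Ψ ∧
    ∀ i, ∀ t ∈ Icc (0 : ℝ) 1, Φ (φ i t) = ψ i (Φ t)

/-- The dual Cantor set of pasts `y = (… y₋₂ y₋₁)`; the value at `n` is `y_{-(n+1)}`. -/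
abbrev Past : Type := ℕ → Fin 2

/-- The word `y_{-n} … y_{-1}`. -/
def pastWord (y : Past) : ℕ → List (Fin 2)
  | 0 => []
  | n + 1 => y n :: pastWord y n

/-- The ratio geometry of `I_w`: the lengths of the left subinterval `I_{w0}`, of the gap between
the two subintervals, and of the right subinterval `I_{w1}`, each divided by the length of `I_w`. -/
noncomputable def ratioGeometry (φ : Fin 2 → ℝ → ℝ) (w : List (Fin 2)) : ℝ × ℝ × ℝ :=
  let len : ℝ := wordMap φ w 1 - wordMap φ w 0
  ((wordMap φ (w ++ [0]) 1 - wordMap φ (w ++ [0]) 0) / len,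
    (wordMap φ (w ++ [1]) 0 - wordMap φ (w ++ [0]) 1) / len,
    (wordMap φ (w ++ [1]) 1 - wordMap φ (w ++ [1]) 0) / len)

/-- `R` is the scaling function: `R(y)` is the limit of the ratio geometries of the intervals
`I_{y_{-n} … y_{-1}}`. -/
def IsScalingFunction (φ : Fin 2 → ℝ → ℝ) (R : Past → ℝ × ℝ × ℝ) : Prop :=
  ∀ y : Past, Tendsto (fun n : ℕ => ratioGeometry φ (pastWord y n)) atTop (𝓝 (R y))

/-- The past `(… y₋₂ y₋₁ x₀ … x_{n-1})`. -/
def extendPast (y : Past) (x : ℕ → Fin 2) : ℕ → Past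
  | 0 => y
  | n + 1 => fun m => Nat.casesOn m (x n) (extendPast y x n)

/-- The left and right endpoints of the interval `I^y_{x₀ … x_{n-1}}` of the ratio Cantor set: it
starts from `[0,1]`, and `[a,b] = I^y_{x₀ … x_{n-1}}` has a left and a right subinterval whose
proportions are the first and third component of `R(… y₋₂ y₋₁ x₀ … x_{n-1})`. -/
noncomputable def ratioEndpoints (R : Past → ℝ × ℝ × ℝ) (y : Past) (x : ℕ → Fin 2) : ℕ → ℝ × ℝ
  | 0 => (0, 1)
  | n + 1 =>
      let a := (ratioEndpoints R y x n).1
      let b := (ratioEndpoints R y x n).2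
      let ρ := R (extendPast y x n)
      if x n = 0 then (a, a + ρ.1 * (b - a)) else (b - ρ.2.2 * (b - a), b)

/-- The interval `I^y_{x₀ … x_{n-1}}`. -/
noncomputable def ratioInterval (R : Past → ℝ × ℝ × ℝ) (y : Past) (x : ℕ → Fin 2) (n : ℕ) :
    Set ℝ :=
  Icc (ratioEndpoints R y x n).1 (ratioEndpoints R y x n).2

/-- The ratio Cantor set `C^y = ⋂ₙ ⋃ I^y_{x₀ … x_{n-1}}`. -/
noncomputable def ratioCantorSet (R : Past → ℝ × ℝ × ℝ) (y : Past) : Set ℝ :=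
  ⋂ n : ℕ, ⋃ x : ℕ → Fin 2, ratioInterval R y x n

/-- The set `C_w`: the piece `C ∩ I_w`, affinely rescaled so as to have endpoints `0` and `1`. -/
noncomputable def rescaledPiece (φ : Fin 2 → ℝ → ℝ) (w : List (Fin 2)) : Set ℝ :=
  (fun p => (p - wordMap φ w 0) / (wordMap φ w 1 - wordMap φ w 0)) ''
    (cantorSet φ ∩ interval φ w)

/-- The marked Cantor set of the system `θ` is `C^y` with its marking: the underlying sets agree,
and a point has the same code `x₀x₁…` in both (so `S_θ` restricted to `C^y` is the shift). -/
def HasMarkedSet (θ : Fin 2 → ℝ → ℝ) (R : Past → ℝ × ℝ × ℝ) (y : Past) : Prop :=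
  cantorSet θ = ratioCantorSet R y ∧
    ∀ (x : ℕ → Fin 2) (p : ℝ),
      (∀ n, p ∈ interval θ (word x n)) ↔ (∀ n, p ∈ ratioInterval R y x n)

end HyperbolicCantor

/-!
Write `w_n = y_{-n} … y_{-1}` and let `h_n` be the branch `φ_{w_n}` followed by the affine map which
carries `I_{w_n}` onto `[0,1]`. The whole theorem rests on one fact: the maps `h_n` converge to a
diffeomorphism `h = limitMap φ y` of `[0,1]` which is as smooth as the system `φ`
(`IsHyperbolic.isOfClass_limitMap`). It holds because
`D φ_{w_n}(t) / D φ_{w_n}(x) = ∏_{j<n} (1 + ε_j(t))`, where `1 + ε_j` is the relative variation of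
`D φ_{y_{-j-1}}` over `I_{w_j}`, and `I_{w_j}` is exponentially small.

* In the class `C^{k+γ}` the norms of the `ε_j` decay geometrically
  (`IsHyperbolic.exists_distortion_bound`, by induction on `k`: a bound for the products at one
  order bounds the `φ_w` one order higher, and so the `ε_j` as well). The telescoping series of
  the `φ_{w_n}`, normalized to have value `0` and derivative `1` at a base point, then converges in
  `C^{k+1+γ}`. The class `C^∞` is the intersection of these.
* In the analytic class the same products are estimated on a complex disc about the base point, on
  which the iterates of the holomorphic extensions of the branches are shown to remain defined
  (`exists_holomorphic_limit`).

Since `w_n` followed by `x₀ … x_{m-1}` is a word of the past `… y₋₁ x₀ … x_{m-1}`, the limit map at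
that past is the rescaled restriction of `h` to `I_{x₀ … x_{m-1}}`. Hence the scaling function can
be read off from the limit maps, `h` carries `I_{x₀ … x_{m-1}}` onto `I^y_{x₀ … x_{m-1}}`, and
uniform convergence `h_n → h` gives the Hausdorff convergence of `C ∩ I_{w_n}`, rescaled, to
`C^y = h(C)`.

If `Φ` conjugates `φ` to a system `ψ` of class `C^r`, then `Φ` is asymptotically affine on the
intervals `I_{w_n}`, so that `limitMap ψ y ∘ Φ = limitMap φ y` (`IsHyperbolic.limitMap_comp`).
The system `θ_i = H ∘ ψ_i ∘ H⁻¹`, `H = limitMap ψ y`, is therefore `C^r`-conjugate to `ψ` by `H`, is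
`C^{1+γ}`-conjugate to `φ` by `limitMap φ y`, and has the marked Cantor set `C^y`. The second
conjugacy is taken from the limit map of `φ` and not from `H ∘ Φ` because `r` may be a lower degree
of smoothness than `1+γ`.
-/

namespace HyperbolicCantor

local notation "𝕀" => Icc (0 : ℝ) 1

/-! ### Quantitative Hölder classes on the unit interval -/

/-- Quantitative `C^{k+γ}` class on `[0,1]`: `f` and its first `k` derivatives are bounded by `K`,
and the `k`-th derivative is `γ`-Hölder with constant `K`. -/
def HolderBound (γ : ℝ) : ℕ → ℝ → (ℝ → ℝ) → Prop
  | 0, K, f => (∀ t ∈ 𝕀, |f t| ≤ K) ∧ ∀ s ∈ 𝕀, ∀ t ∈ 𝕀, |f s - f t| ≤ K * |s - t| ^ γ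
  | k + 1, K, f => (∀ t ∈ 𝕀, |f t| ≤ K) ∧
      ∃ f' : ℝ → ℝ, (∀ t ∈ 𝕀, HasDerivWithinAt f (f' t) 𝕀 t) ∧ HolderBound γ k K f'

lemma zero_mem_unit : (0 : ℝ) ∈ 𝕀 := ⟨le_rfl, zero_le_one⟩

lemma one_mem_unit : (1 : ℝ) ∈ 𝕀 := ⟨zero_le_one, le_rfl⟩

lemma abs_sub_le_one {s t : ℝ} (hs : s ∈ 𝕀) (ht : t ∈ 𝕀) : |s - t| ≤ 1 := by
  rw [abs_le]; constructor <;> linarith [hs.1, hs.2, ht.1, ht.2]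

lemma uniqueDiffOn_unit : UniqueDiffOn ℝ 𝕀 := uniqueDiffOn_Icc zero_lt_one

/-- Mean value inequality on `[0,1]`. -/
lemma abs_sub_le_of_hasDerivWithinAt {f f' : ℝ → ℝ} {K : ℝ}
    (hf : ∀ t ∈ 𝕀, HasDerivWithinAt f (f' t) 𝕀 t) (hK : ∀ t ∈ 𝕀, |f' t| ≤ K) {s t : ℝ}
    (hs : s ∈ 𝕀) (ht : t ∈ 𝕀) : |f s - f t| ≤ K * |s - t| :=
  Convex.norm_image_sub_le_of_norm_hasDerivWithin_le hf hK (convex_Icc 0 1) ht hs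

namespace HolderBound

variable {γ : ℝ} {k : ℕ} {K L : ℝ} {f g : ℝ → ℝ}

lemma abs_le (h : HolderBound γ k K f) {t : ℝ} (ht : t ∈ 𝕀) : |f t| ≤ K := by
  cases k <;> exact h.1 t ht

lemma nonneg (h : HolderBound γ k K f) : 0 ≤ K :=
  (abs_nonneg _).trans (h.abs_le zero_mem_unit)

lemma mono (h : HolderBound γ k K f) (hKL : K ≤ L) : HolderBound γ k L f := by
  induction k generalizing f with
  | zero =>
    exact ⟨fun t ht => (h.1 t ht).trans hKL, fun s hs t ht => (h.2 s hs t ht).trans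
      (mul_le_mul_of_nonneg_right hKL (Real.rpow_nonneg (abs_nonneg _) _))⟩
  | succ k ih =>
    obtain ⟨h0, f', hf', h1⟩ := h
    exact ⟨fun t ht => (h0 t ht).trans hKL, f', hf', ih h1⟩

lemma congr (h : HolderBound γ k K f) (hfg : EqOn g f 𝕀) : HolderBound γ k K g := by
  cases k with
  | zero =>
    refine ⟨fun t ht => by rw [hfg ht]; exact h.1 t ht, fun s hs t ht => ?_⟩
    rw [hfg ht, hfg hs]; exact h.2 s hs t ht
  | succ k =>
    obtain ⟨h0, f', hf', h1⟩ := h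
    exact ⟨fun t ht => by rw [hfg ht]; exact h0 t ht, f',
      fun t ht => (hf' t ht).congr hfg (hfg ht), h1⟩

lemma continuousOn (h : HolderBound γ k K f) (hγ₀ : 0 < γ) : ContinuousOn f 𝕀 := by
  cases k with
  | zero =>
    intro t ht
    have h1 : Tendsto (fun s => K * |s - t| ^ γ) (𝓝[𝕀] t) (𝓝 0) := by
      have : ContinuousAt (fun s : ℝ => K * |s - t| ^ γ) t := by
        refine continuousAt_const.mul (ContinuousAt.rpow_const (by fun_prop) (Or.inr hγ₀.le))
      have h2 := this.tendsto
      simp only [sub_self, abs_zero, Real.zero_rpow hγ₀.ne', mul_zero] at h2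
      exact h2.mono_left nhdsWithin_le_nhds
    rw [ContinuousWithinAt, tendsto_iff_norm_sub_tendsto_zero]
    refine squeeze_zero' (Eventually.of_forall fun _ => norm_nonneg _) ?_ h1
    filter_upwards [self_mem_nhdsWithin] with s hs using h.2 s hs t ht
  | succ k =>
    obtain ⟨-, f', hf', -⟩ := h
    exact fun t ht => (hf' t ht).continuousWithinAt

lemma zero_of_lipschitz (hγ₁ : γ ≤ 1) (h0 : ∀ t ∈ 𝕀, |f t| ≤ K)
    (h1 : ∀ s ∈ 𝕀, ∀ t ∈ 𝕀, |f s - f t| ≤ K * |s - t|) : HolderBound γ 0 K f := by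
  refine ⟨h0, fun s hs t ht => (h1 s hs t ht).trans ?_⟩
  have hK : 0 ≤ K := (abs_nonneg _).trans (h0 0 zero_mem_unit)
  refine mul_le_mul_of_nonneg_left ?_ hK
  rcases (abs_nonneg (s - t)).eq_or_lt with h | h
  · rw [← h]; positivity
  · simpa using Real.rpow_le_rpow_of_exponent_ge h (abs_sub_le_one hs ht) hγ₁

lemma pred (hγ₁ : γ ≤ 1) (h : HolderBound γ (k + 1) K f) : HolderBound γ k K f := by
  induction k generalizing f with
  | zero =>
    obtain ⟨h0, f', hf', h1⟩ := h
    exact zero_of_lipschitz hγ₁ h0 fun s hs t ht =>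
      abs_sub_le_of_hasDerivWithinAt hf' h1.1 hs ht
  | succ k ih =>
    obtain ⟨h0, f', hf', h1⟩ := h
    exact ⟨h0, f', hf', ih h1⟩

lemma const (γ : ℝ) (k : ℕ) (c : ℝ) : HolderBound γ k |c| (fun _ => c) := by
  induction k generalizing c with
  | zero =>
    refine ⟨fun _ _ => le_rfl, fun s _ t _ => ?_⟩
    rw [sub_self, abs_zero]; positivity
  | succ k ih =>
    refine ⟨fun _ _ => le_rfl, fun _ => 0, fun t _ => hasDerivWithinAt_const _ _ _, ?_⟩
    exact (ih 0).mono (by simp)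

lemma add (hf : HolderBound γ k K f) (hg : HolderBound γ k L g) :
    HolderBound γ k (K + L) (fun t => f t + g t) := by
  induction k generalizing f g with
  | zero =>
    refine ⟨fun t ht => (abs_add_le _ _).trans (add_le_add (hf.1 t ht) (hg.1 t ht)),
      fun s hs t ht => ?_⟩
    rw [add_mul, add_sub_add_comm]
    exact (abs_add_le _ _).trans (add_le_add (hf.2 s hs t ht) (hg.2 s hs t ht))
  | succ k ih =>
    obtain ⟨h0, f', hf', h1⟩ := hf
    obtain ⟨j0, g', hg', j1⟩ := hg
    exact ⟨fun t ht => (abs_add_le _ _).trans (add_le_add (h0 t ht) (j0 t ht)), _,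
      fun t ht => (hf' t ht).add (hg' t ht), ih h1 j1⟩

lemma mul (hγ₁ : γ ≤ 1) (hf : HolderBound γ k K f) (hg : HolderBound γ k L g) :
    HolderBound γ k (2 ^ (k + 1) * K * L) (fun t => f t * g t) := by
  have hK := hf.nonneg
  have hL := hg.nonneg
  have key : ∀ k : ℕ, K * L ≤ 2 ^ (k + 1) * K * L := fun k => by
    have : (1 : ℝ) ≤ 2 ^ (k + 1) := one_le_pow₀ (by norm_num)
    nlinarith [mul_nonneg hK hL]
  have bd : ∀ t ∈ 𝕀, |f t * g t| ≤ K * L := fun t ht => by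
    rw [abs_mul]; exact mul_le_mul (hf.abs_le ht) (hg.abs_le ht) (abs_nonneg _) hK
  induction k generalizing f g with
  | zero =>
    refine ⟨fun t ht => (bd t ht).trans (key 0), fun s hs t ht => ?_⟩
    have e : f s * g s - f t * g t = f s * (g s - g t) + g t * (f s - f t) := by ring
    rw [e]
    refine (abs_add_le _ _).trans ?_
    rw [abs_mul, abs_mul]
    have h1 := mul_le_mul (hf.1 s hs) (hg.2 s hs t ht) (abs_nonneg _) hK
    have h2 := mul_le_mul (hg.1 t ht) (hf.2 s hs t ht) (abs_nonneg _) hL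
    rw [zero_add, pow_one]
    linarith
  | succ k ih =>
    have hf₀ := hf.pred hγ₁
    have hg₀ := hg.pred hγ₁
    obtain ⟨h0, f', hf', h1⟩ := hf
    obtain ⟨j0, g', hg', j1⟩ := hg
    refine ⟨fun t ht => (bd t ht).trans (key _), _, fun t ht => (hf' t ht).mul (hg' t ht), ?_⟩
    have hb : ∀ {a b : ℝ → ℝ}, HolderBound γ k K a → HolderBound γ k L b →
        ∀ t ∈ 𝕀, |a t * b t| ≤ K * L := fun ha hb t ht => by
      rw [abs_mul]; exact mul_le_mul (ha.abs_le ht) (hb.abs_le ht) (abs_nonneg _) hK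
    refine ((ih h1 hg₀ (hb h1 hg₀)).add (ih hf₀ j1 (hb hf₀ j1))).mono (le_of_eq ?_)
    ring

lemma const_mul (hγ₁ : γ ≤ 1) (c : ℝ) (hf : HolderBound γ k K f) :
    HolderBound γ k (2 ^ (k + 1) * |c| * K) (fun t => c * f t) :=
  (const γ k c).mul hγ₁ hf

lemma comp_of_lipschitz (hγ₀ : 0 < γ) (hm : MapsTo f 𝕀 𝕀) (hg : HolderBound γ 0 K g)
    (hL : 0 ≤ L) (hf : ∀ s ∈ 𝕀, ∀ t ∈ 𝕀, |f s - f t| ≤ L * |s - t|) :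
    HolderBound γ 0 (max K (K * L ^ γ)) (fun t => g (f t)) := by
  have hK : 0 ≤ K := hg.nonneg
  refine ⟨fun t ht => (hg.1 _ (hm ht)).trans (le_max_left _ _), fun s hs t ht => ?_⟩
  refine (hg.2 _ (hm hs) _ (hm ht)).trans ?_
  have h3 : |f s - f t| ^ γ ≤ L ^ γ * |s - t| ^ γ := by
    rw [← Real.mul_rpow hL (abs_nonneg _)]
    exact Real.rpow_le_rpow (abs_nonneg _) (hf s hs t ht) hγ₀.le
  calc K * |f s - f t| ^ γ ≤ K * (L ^ γ * |s - t| ^ γ) := mul_le_mul_of_nonneg_left h3 hK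
    _ = (K * L ^ γ) * |s - t| ^ γ := by ring
    _ ≤ _ := mul_le_mul_of_nonneg_right (le_max_right _ _) (by positivity)

/-- The composition `v ∘ f` is controlled by the bounds of `v` and of `f`; one more derivative of
`f` is assumed, so that `f` is Lipschitz already for `k = 0`. -/
lemma comp_of_succ (hγ₀ : 0 < γ) (hγ₁ : γ ≤ 1) (k : ℕ) (K L : ℝ) :
    ∃ M, ∀ v f : ℝ → ℝ, MapsTo f 𝕀 𝕀 → HolderBound γ k K v → HolderBound γ (k + 1) L f →
      HolderBound γ k M (fun t => v (f t)) := by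
  induction k with
  | zero =>
    refine ⟨max K (K * L ^ γ), fun v f hm hv hf => ?_⟩
    obtain ⟨h0, f', hf', h1⟩ := hf
    exact comp_of_lipschitz hγ₀ hm hv h1.nonneg fun s hs t ht =>
      abs_sub_le_of_hasDerivWithinAt hf' h1.1 hs ht
  | succ k ih =>
    obtain ⟨M, hM⟩ := ih
    refine ⟨max K (2 ^ (k + 1) * M * L), fun v f hm hv hf => ?_⟩
    have hf₀ := hf.pred hγ₁
    obtain ⟨h0, f', hf', h1⟩ := hf
    obtain ⟨j0, v', hv', j1⟩ := hv
    refine ⟨fun t ht => (j0 _ (hm ht)).trans (le_max_left _ _), _,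
      fun t ht => (hv' _ (hm ht)).comp t (hf' t ht) hm, ?_⟩
    exact ((hM v' f hm j1 hf₀).mul hγ₁ (h1.pred hγ₁)).mono (le_max_right _ _)

lemma comp (hγ₀ : 0 < γ) (hγ₁ : γ ≤ 1) (hm : MapsTo f 𝕀 𝕀) (hg : HolderBound γ (k + 1) K g)
    (hf : HolderBound γ (k + 1) L f) : ∃ M, HolderBound γ (k + 1) M (fun t => g (f t)) := by
  obtain ⟨M, hM⟩ := comp_of_succ hγ₀ hγ₁ k K L
  have hf₀ := hf
  obtain ⟨h0, f', hf', h1⟩ := hf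
  obtain ⟨j0, v', hv', j1⟩ := hg
  refine ⟨max K (2 ^ (k + 1) * M * L), fun t ht => (j0 _ (hm ht)).trans (le_max_left _ _), _,
      fun t ht => (hv' _ (hm ht)).comp t (hf' t ht) hm, ?_⟩
  exact ((hM v' f hm j1 hf₀).mul hγ₁ h1).mono (le_max_right _ _)

lemma inv (hγ₁ : γ ≤ 1) {α : ℝ} (hα : 0 < α) (hf : HolderBound γ k K f)
    (hlow : ∀ t ∈ 𝕀, α ≤ f t) : ∃ M, HolderBound γ k M (fun t => (f t)⁻¹) := by
  have hbd : ∀ t ∈ 𝕀, |(f t)⁻¹| ≤ α⁻¹ := fun t ht => by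
    rw [abs_inv]
    exact inv_anti₀ hα ((hlow t ht).trans (le_abs_self _))
  induction k with
  | zero =>
    refine ⟨max α⁻¹ (α⁻¹ * α⁻¹ * K), fun t ht => (hbd t ht).trans (le_max_left _ _),
      fun s hs t ht => ?_⟩
    have h1 : f s ≠ 0 := (hα.trans_le (hlow s hs)).ne'
    have h2 : f t ≠ 0 := (hα.trans_le (hlow t ht)).ne'
    have e : (f s)⁻¹ - (f t)⁻¹ = (f s)⁻¹ * (f t)⁻¹ * (f t - f s) := by field_simp
    rw [e, abs_mul, abs_mul, abs_sub_comm]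
    calc |(f s)⁻¹| * |(f t)⁻¹| * |f s - f t| ≤ α⁻¹ * α⁻¹ * (K * |s - t| ^ γ) := by
          gcongr
          exacts [hbd s hs, hbd t ht, hf.2 s hs t ht]
      _ = α⁻¹ * α⁻¹ * K * |s - t| ^ γ := by ring
      _ ≤ _ := mul_le_mul_of_nonneg_right (le_max_right _ _) (by positivity)
  | succ k ih =>
    obtain ⟨M, hM⟩ := ih (hf.pred hγ₁)
    obtain ⟨h0, f', hf', h1⟩ := hf
    have h2 := (((h1.mul hγ₁ (hM.mul hγ₁ hM))).const_mul hγ₁ (-1))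
    refine ⟨max α⁻¹ _, fun t ht => (hbd t ht).trans (le_max_left _ _),
      fun t => -1 * (f' t * ((f t)⁻¹ * (f t)⁻¹)), fun t ht => ?_, h2.mono (le_max_right _ _)⟩
    have h3 := (hf' t ht).inv (hα.trans_le (hlow t ht)).ne'
    refine h3.congr_deriv ?_
    rw [div_eq_mul_inv, sq, mul_inv]
    ring

end HolderBound

/-- A function with continuous derivative on `[0,1]` extends to a differentiable function
on the line, by continuing its derivative by constants. -/
lemma exists_hasDerivAt_extension {f f' : ℝ → ℝ} (hf : ∀ t ∈ 𝕀, HasDerivWithinAt f (f' t) 𝕀 t)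
    (hc : ContinuousOn f' 𝕀) :
    ∃ F : ℝ → ℝ, EqOn F f 𝕀 ∧ ∀ t, HasDerivAt F (f' (projIcc 0 1 zero_le_one t)) t := by
  have hcont : Continuous fun t : ℝ => f' (projIcc 0 1 zero_le_one t) :=
    (continuousOn_iff_continuous_domRestrict.1 hc).comp continuous_projIcc
  refine ⟨fun t => f 0 + ∫ s in (0 : ℝ)..t, f' (projIcc 0 1 zero_le_one s), fun t ht => ?_,
    fun t => ?_⟩
  · have h1 : ∫ s in (0 : ℝ)..t, f' (projIcc 0 1 zero_le_one s) = f t - f 0 := by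
      refine intervalIntegral.integral_eq_sub_of_hasDeriv_right ?_ (fun s hs => ?_)
        (hcont.intervalIntegrable _ _)
      · rw [uIcc_of_le ht.1]
        exact fun s hs => ((hf s ⟨hs.1, hs.2.trans ht.2⟩).continuousWithinAt).mono
          (Icc_subset_Icc le_rfl ht.2)
      · rw [min_eq_left ht.1, max_eq_right ht.1] at hs
        have hs1 : s ∈ 𝕀 := ⟨hs.1.le, hs.2.le.trans ht.2⟩
        rw [projIcc_of_mem zero_le_one hs1]
        exact ((hf s hs1).hasDerivAt
          (Icc_mem_nhds hs.1 (hs.2.trans_le ht.2))).hasDerivWithinAt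
    simp only [h1]; ring
  · exact (intervalIntegral.integral_hasDerivAt_right (hcont.intervalIntegrable _ _)
      (hcont.stronglyMeasurableAtFilter _ _) hcont.continuousAt).const_add _

lemma hasDerivWithinAt_tsum {f f' : ℕ → ℝ → ℝ} {u : ℕ → ℝ} (hu : Summable u)
    (hf : ∀ n, ∀ t ∈ 𝕀, HasDerivWithinAt (f n) (f' n t) 𝕀 t) (hc : ∀ n, ContinuousOn (f' n) 𝕀)
    (hf' : ∀ n, ∀ t ∈ 𝕀, |f' n t| ≤ u n) (h0 : Summable fun n => f n 0) {t : ℝ} (ht : t ∈ 𝕀) :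
    HasDerivWithinAt (fun t => ∑' n, f n t) (∑' n, f' n t) 𝕀 t := by
  choose F hF hF' using fun n => exists_hasDerivAt_extension (hf n) (hc n)
  have h1 := hasDerivAt_tsum (y₀ := (0 : ℝ)) hu hF' (fun n y => hf' n _ (Subtype.coe_prop _))
    (by simpa only [fun n => hF n zero_mem_unit] using h0) t
  have h2 := h1.hasDerivWithinAt (s := 𝕀)
  simp only [projIcc_of_mem zero_le_one ht] at h2
  refine h2.congr (fun s hs => ?_) ?_
  · simp only [fun n => hF n hs]
  · simp only [fun n => hF n ht]

lemma HolderBound.summable {γ : ℝ} {k : ℕ} {K : ℕ → ℝ} {f : ℕ → ℝ → ℝ}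
    (hf : ∀ n, HolderBound γ k (K n) (f n)) (hK : Summable K) {t : ℝ} (ht : t ∈ 𝕀) :
    Summable fun n => f n t :=
  Summable.of_norm_bounded hK fun n => (hf n).abs_le ht

lemma HolderBound.tsum {γ : ℝ} (hγ₀ : 0 < γ) {k : ℕ} {K : ℕ → ℝ} {f : ℕ → ℝ → ℝ}
    (hf : ∀ n, HolderBound γ k (K n) (f n)) (hK : Summable K) :
    HolderBound γ k (∑' n, K n) (fun t => ∑' n, f n t) := by
  induction k generalizing f with
  | zero =>
    refine ⟨fun t ht => by
      rw [← Real.norm_eq_abs]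
      exact tsum_of_norm_bounded hK.hasSum fun n => (hf n).abs_le ht,
      fun s hs t ht => ?_⟩
    rw [← (HolderBound.summable hf hK hs).tsum_sub (HolderBound.summable hf hK ht)]
    rw [← Real.norm_eq_abs, ← tsum_mul_right]
    exact tsum_of_norm_bounded (hK.mul_right _).hasSum fun n => (hf n).2 s hs t ht
  | succ k ih =>
    refine ⟨fun t ht => by
      rw [← Real.norm_eq_abs]
      exact tsum_of_norm_bounded hK.hasSum fun n => (hf n).abs_le ht, ?_⟩
    choose f' hf' h1 using fun n => (hf n).2
    exact ⟨fun t => ∑' n, f' n t, fun t ht => hasDerivWithinAt_tsum hK hf'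
      (fun n => (h1 n).continuousOn hγ₀) (fun n t ht => (h1 n).abs_le ht)
      (HolderBound.summable hf hK zero_mem_unit) ht, ih h1⟩

/-! ### Degrees of smoothness and inverse functions -/

lemma contDiffOn_and_holder_iff {γ : ℝ} (hγ₀ : 0 < γ) {k : ℕ} {f : ℝ → ℝ} :
    (ContDiffOn ℝ k f 𝕀 ∧ ∃ K : ℝ, ∀ s ∈ 𝕀, ∀ t ∈ 𝕀,
      |iteratedDerivWithin k f 𝕀 s - iteratedDerivWithin k f 𝕀 t| ≤ K * |s - t| ^ γ) ↔
    ∃ K, HolderBound γ k K f := by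
  have bdd : ∀ g : ℝ → ℝ, ContinuousOn g 𝕀 → ∃ K, ∀ t ∈ 𝕀, |g t| ≤ K := fun g hg =>
    isCompact_Icc.exists_bound_of_continuousOn hg
  induction k generalizing f with
  | zero =>
    simp only [iteratedDerivWithin_zero]
    constructor
    · rintro ⟨h, K, hK⟩
      obtain ⟨L, hL⟩ := bdd f h.continuousOn
      exact ⟨max L K, fun t ht => (hL t ht).trans (le_max_left _ _), fun s hs t ht =>
        (hK s hs t ht).trans (mul_le_mul_of_nonneg_right (le_max_right _ _) (by positivity))⟩
    · rintro ⟨K, hK⟩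
      exact ⟨contDiffOn_zero.2 (hK.continuousOn hγ₀), K, hK.2⟩
  | succ k ih =>
    have h1 : ContDiffOn ℝ ((k + 1 : ℕ) : WithTop ℕ∞) f 𝕀 ↔
        DifferentiableOn ℝ f 𝕀 ∧ ContDiffOn ℝ k (derivWithin f 𝕀) 𝕀 := by
      rw [Nat.cast_add, Nat.cast_one, contDiffOn_succ_iff_derivWithin uniqueDiffOn_unit]
      simp
    rw [h1, and_assoc]
    simp only [iteratedDerivWithin_succ', ih]
    constructor
    · rintro ⟨hd, K, hK⟩
      obtain ⟨L, hL⟩ := bdd f hd.continuousOn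
      exact ⟨max L K, fun t ht => (hL t ht).trans (le_max_left _ _), _,
        fun t ht => (hd t ht).hasDerivWithinAt, hK.mono (le_max_right _ _)⟩
    · rintro ⟨K, h0, f', hf', hK⟩
      exact ⟨fun t ht => (hf' t ht).differentiableWithinAt, K,
        hK.congr fun t ht => (hf' t ht).derivWithin (uniqueDiffOn_unit t ht)⟩

lemma isOfClass_holder_iff {k : ℕ} {γ : ℝ} (hk : 1 ≤ k) (hγ₀ : 0 < γ) (hγ₁ : γ ≤ 1)
    {f : ℝ → ℝ} : IsOfClass (.holder k γ hk hγ₀ hγ₁) f ↔ ∃ K, HolderBound γ k K f :=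
  contDiffOn_and_holder_iff hγ₀

lemma exists_holderBound_of_contDiffOn {γ : ℝ} (hγ₁ : γ ≤ 1) {k : ℕ} {f : ℝ → ℝ}
    (hf : ContDiffOn ℝ ((k + 1 : ℕ) : WithTop ℕ∞) f 𝕀) : ∃ K, HolderBound γ k K f := by
  have h0 : ∃ K, ∀ t ∈ 𝕀, |f t| ≤ K :=
    isCompact_Icc.exists_bound_of_continuousOn hf.continuousOn
  obtain ⟨L, hL⟩ := h0
  rw [Nat.cast_add, Nat.cast_one, contDiffOn_succ_iff_derivWithin uniqueDiffOn_unit] at hf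
  obtain ⟨hd, -, hc⟩ := hf
  have hd' : ∀ t ∈ 𝕀, HasDerivWithinAt f (derivWithin f 𝕀 t) 𝕀 t :=
    fun t ht => (hd t ht).hasDerivWithinAt
  induction k generalizing f L with
  | zero =>
    obtain ⟨K, hK⟩ : ∃ K, ∀ t ∈ 𝕀, |derivWithin f 𝕀 t| ≤ K :=
      isCompact_Icc.exists_bound_of_continuousOn hc.continuousOn
    refine ⟨max L K, .zero_of_lipschitz hγ₁ (fun t ht => (hL t ht).trans (le_max_left _ _))
      fun s hs t ht => abs_sub_le_of_hasDerivWithinAt hd'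
        (fun t ht => (hK t ht).trans (le_max_right _ _)) hs ht⟩
  | succ k ih =>
    obtain ⟨M, hM⟩ : ∃ K, ∀ t ∈ 𝕀, |derivWithin f 𝕀 t| ≤ K :=
      isCompact_Icc.exists_bound_of_continuousOn hc.continuousOn
    have hc' := hc
    rw [Nat.cast_add, Nat.cast_one, contDiffOn_succ_iff_derivWithin uniqueDiffOn_unit] at hc'
    obtain ⟨K, hK⟩ := ih M hM hc'.1 hc'.2.2 fun t ht => (hc'.1 t ht).hasDerivWithinAt
    exact ⟨max L K, fun t ht => (hL t ht).trans (le_max_left _ _), _, hd',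
      hK.mono (le_max_right _ _)⟩

lemma isOfClass_smooth_iff {f : ℝ → ℝ} :
    IsOfClass .smooth f ↔ ∀ k, ∃ K, HolderBound 1 (k + 1) K f := by
  simp only [IsOfClass]
  rw [contDiffOn_infty]
  exact ⟨fun h k => exists_holderBound_of_contDiffOn le_rfl (h _), fun h k =>
    ((contDiffOn_and_holder_iff one_pos).2 (h k)).1.of_le (by exact_mod_cast k.le_succ)⟩

/-- A Hölder exponent `γ` such that functions of class `C^r` are of class `C^{1+γ}`. -/
noncomputable def Degree.exponent : Degree → ℝ
  | .holder _ γ _ _ _ => γ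
  | .smooth => 1
  | .analytic => 1

lemma Degree.exponent_pos (r : Degree) : 0 < r.exponent := by
  cases r <;> simp [Degree.exponent, *]

lemma Degree.exponent_le_one (r : Degree) : r.exponent ≤ 1 := by
  cases r <;> simp [Degree.exponent, *]

namespace IsOfClass

variable {r : Degree} {f g : ℝ → ℝ}

lemma exists_holderBound (h : IsOfClass r f) : ∃ K, HolderBound r.exponent 1 K f := by
  cases r with
  | holder k γ hk hγ₀ hγ₁ =>
    obtain ⟨K, hK⟩ := (isOfClass_holder_iff hk hγ₀ hγ₁).1 h
    refine ⟨K, ?_⟩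
    simp only [Degree.exponent]
    induction k, hk using Nat.le_induction with
    | base => exact hK
    | succ k hk ih =>
      exact ih ((isOfClass_holder_iff hk hγ₀ hγ₁).2 ⟨K, hK.pred hγ₁⟩) (hK.pred hγ₁)
  | smooth => exact isOfClass_smooth_iff.1 h 0
  | analytic =>
    exact exists_holderBound_of_contDiffOn le_rfl (AnalyticOn.contDiffOn h uniqueDiffOn_unit)

lemma differentiableOn (h : IsOfClass r f) : DifferentiableOn ℝ f 𝕀 := by
  obtain ⟨K, -, f', hf', -⟩ := h.exists_holderBound
  exact fun t ht => (hf' t ht).differentiableWithinAt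

lemma hasDerivWithinAt (h : IsOfClass r f) {t : ℝ} (ht : t ∈ 𝕀) :
    HasDerivWithinAt f (derivWithin f 𝕀 t) 𝕀 t :=
  (h.differentiableOn t ht).hasDerivWithinAt

lemma continuousOn_derivWithin (h : IsOfClass r f) : ContinuousOn (derivWithin f 𝕀) 𝕀 := by
  obtain ⟨K, -, f', hf', h1⟩ := h.exists_holderBound
  exact (h1.continuousOn r.exponent_pos).congr fun t ht =>
    (hf' t ht).derivWithin (uniqueDiffOn_unit t ht)

lemma comp (hg : IsOfClass r g) (hf : IsOfClass r f) (hm : MapsTo f 𝕀 𝕀) :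
    IsOfClass r (fun t => g (f t)) := by
  cases r with
  | holder k γ hk hγ₀ hγ₁ =>
    rw [isOfClass_holder_iff] at hf hg ⊢
    obtain ⟨k, rfl⟩ := Nat.exists_eq_add_of_le' hk
    obtain ⟨K, hK⟩ := hg
    obtain ⟨L, hL⟩ := hf
    exact hK.comp hγ₀ hγ₁ hm hL
  | smooth => exact ContDiffOn.comp hg hf hm
  | analytic => exact AnalyticOn.comp hg hf hm

end IsOfClass

/-- Lower form of the mean value inequality on `[0,1]`. -/
lemma mul_sub_le_of_hasDerivWithinAt {f f' : ℝ → ℝ} {α : ℝ}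
    (hf : ∀ t ∈ 𝕀, HasDerivWithinAt f (f' t) 𝕀 t) (hα : ∀ t ∈ 𝕀, α ≤ f' t) {s t : ℝ}
    (hs : s ∈ 𝕀) (ht : t ∈ 𝕀) (hst : s ≤ t) : α * (t - s) ≤ f t - f s := by
  have hd : ∀ x ∈ interior 𝕀, HasDerivAt f (f' x) x := fun x hx => by
    have hx' := interior_subset hx
    exact (hf x hx').hasDerivAt (mem_interior_iff_mem_nhds.1 hx)
  exact (convex_Icc 0 1).mul_sub_le_image_sub_of_le_deriv
    (fun x hx => (hf x hx).continuousWithinAt)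
    (fun x hx => (hd x hx).differentiableAt.differentiableWithinAt)
    (fun x hx => by rw [(hd x hx).deriv]; exact hα x (interior_subset hx)) s hs t ht hst

lemma mul_abs_sub_le_of_hasDerivWithinAt {f f' : ℝ → ℝ} {α : ℝ}
    (hf : ∀ t ∈ 𝕀, HasDerivWithinAt f (f' t) 𝕀 t) (hα : ∀ t ∈ 𝕀, α ≤ f' t) {s t : ℝ}
    (hs : s ∈ 𝕀) (ht : t ∈ 𝕀) : α * |s - t| ≤ |f s - f t| := by
  rcases le_total s t with h | h
  · have := mul_sub_le_of_hasDerivWithinAt hf hα hs ht h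
    rw [abs_sub_comm s t, abs_sub_comm (f s), abs_of_nonneg (sub_nonneg.2 h)]
    exact this.trans (le_abs_self _)
  · have := mul_sub_le_of_hasDerivWithinAt hf hα ht hs h
    rw [abs_of_nonneg (sub_nonneg.2 h)]
    exact this.trans (le_abs_self _)

section Inverse

variable {f g : ℝ → ℝ} {α : ℝ}

lemma hasDerivWithinAt_inverse {f' : ℝ → ℝ} (hα : 0 < α)
    (hf : ∀ t ∈ 𝕀, HasDerivWithinAt f (f' t) 𝕀 t) (hlow : ∀ t ∈ 𝕀, α ≤ f' t)
    (hg : MapsTo g 𝕀 𝕀) (hfg : RightInvOn g f 𝕀) :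
    (∀ s ∈ 𝕀, ∀ t ∈ 𝕀, |g s - g t| ≤ α⁻¹ * |s - t|) ∧
      ∀ t ∈ 𝕀, HasDerivWithinAt g (f' (g t))⁻¹ 𝕀 t := by
  have hlip : ∀ s ∈ 𝕀, ∀ t ∈ 𝕀, |g s - g t| ≤ α⁻¹ * |s - t| := fun s hs t ht => by
    have := mul_abs_sub_le_of_hasDerivWithinAt hf hlow (hg hs) (hg ht)
    rw [hfg hs, hfg ht] at this
    rwa [le_inv_mul_iff₀ hα]
  refine ⟨hlip, fun t ht => ?_⟩
  have h0 : f' (g t) ≠ 0 := (hα.trans_le (hlow _ (hg ht))).ne'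
  have hcont : Tendsto g (𝓝[𝕀] t) (𝓝[𝕀] (g t)) := by
    refine tendsto_nhdsWithin_iff.2 ⟨?_, ?_⟩
    · rw [tendsto_iff_norm_sub_tendsto_zero]
      have h2 : ContinuousAt (fun s => α⁻¹ * |s - t|) t := by fun_prop
      have h3 := h2.tendsto
      simp only [sub_self, abs_zero, mul_zero] at h3
      refine squeeze_zero' (Eventually.of_forall fun _ => norm_nonneg _) ?_
        (h3.mono_left nhdsWithin_le_nhds)
      filter_upwards [self_mem_nhdsWithin] with s hs using hlip s hs t ht
    · filter_upwards [self_mem_nhdsWithin] with s hs using hg hs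
  have h1 : HasFDerivWithinAt f
      ((ContinuousLinearEquiv.unitsEquivAut ℝ (Units.mk0 _ h0) : ℝ ≃L[ℝ] ℝ) : ℝ →L[ℝ] ℝ)
      𝕀 (g t) := by
    have := (hf _ (hg ht)).hasFDerivWithinAt
    refine this.congr_fderiv ?_
    ext; simp
  have h2 := h1.of_local_left_inverse hcont ht
    (by filter_upwards [self_mem_nhdsWithin] with s hs using hfg hs)
  refine h2.hasDerivWithinAt.congr_deriv ?_
  simp [ContinuousLinearEquiv.unitsEquivAut]

lemma HolderBound.inverse {γ : ℝ} (hγ₀ : 0 < γ) (hγ₁ : γ ≤ 1) {k : ℕ} {K : ℝ}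
    (hf : HolderBound γ (k + 1) K f) (hα : 0 < α) (hlow : ∀ t ∈ 𝕀, α ≤ derivWithin f 𝕀 t)
    (hg : MapsTo g 𝕀 𝕀) (hfg : RightInvOn g f 𝕀) : ∃ M, HolderBound γ (k + 1) M g := by
  have hb : ∀ t ∈ 𝕀, |g t| ≤ 1 := fun t ht => by
    rw [_root_.abs_le]; constructor <;> linarith [(hg ht).1, (hg ht).2]
  have main : ∀ k K, HolderBound γ (k + 1) K f → ∃ f' : ℝ → ℝ,
      HolderBound γ k K f' ∧ (∀ t ∈ 𝕀, α ≤ f' t) ∧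
      (∀ s ∈ 𝕀, ∀ t ∈ 𝕀, |g s - g t| ≤ α⁻¹ * |s - t|) ∧
      ∀ t ∈ 𝕀, HasDerivWithinAt g (f' (g t))⁻¹ 𝕀 t := by
    intro k K hf
    obtain ⟨h0, f', hf', h1⟩ := hf
    have hlow' : ∀ t ∈ 𝕀, α ≤ f' t := fun t ht => by
      rw [← (hf' t ht).derivWithin (uniqueDiffOn_unit t ht)]; exact hlow t ht
    exact ⟨f', h1, hlow', hasDerivWithinAt_inverse hα hf' hlow' hg hfg⟩
  induction k generalizing K with
  | zero =>
    obtain ⟨f', h1, hlow', hlip, hd⟩ := main 0 K hf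
    obtain ⟨M, hM⟩ := (h1.comp_of_lipschitz hγ₀ hg (inv_nonneg.2 hα.le) hlip).inv hγ₁ hα
      fun t ht => hlow' _ (hg ht)
    exact ⟨max 1 M, fun t ht => (hb t ht).trans (le_max_left _ _), _, hd,
      hM.mono (le_max_right _ _)⟩
  | succ k ih =>
    obtain ⟨L, hL⟩ := ih (hf.pred hγ₁)
    obtain ⟨f', h1, hlow', hlip, hd⟩ := main _ K hf
    obtain ⟨M', hM'⟩ := h1.comp hγ₀ hγ₁ hg hL
    obtain ⟨M, hM⟩ := hM'.inv hγ₁ hα fun t ht => hlow' _ (hg ht)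
    exact ⟨max 1 M, fun t ht => (hb t ht).trans (le_max_left _ _), _, hd,
      hM.mono (le_max_right _ _)⟩

lemma analyticOn_inverse (hf : AnalyticOn ℝ f 𝕀) (hα : 0 < α)
    (hlow : ∀ t ∈ 𝕀, α ≤ derivWithin f 𝕀 t) (hg : MapsTo g 𝕀 𝕀) (hfg : RightInvOn g f 𝕀) :
    AnalyticOn ℝ g 𝕀 := by
  intro s hs
  obtain ⟨F, hF0, hF, hFa⟩ := (hf (g s) (hg hs)).exists_analyticAt
  rw [insert_eq_of_mem (hg hs)] at hF
  have hd' : ∀ t ∈ 𝕀, HasDerivWithinAt f (derivWithin f 𝕀 t) 𝕀 t := fun t ht =>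
    (hf.differentiableOn t ht).hasDerivWithinAt
  have hcont : ContinuousWithinAt g 𝕀 s :=
    ((hasDerivWithinAt_inverse hα hd' hlow hg hfg).2 s hs).continuousWithinAt
  have hder : deriv F (g s) ≠ 0 := by
    have h1 := (hFa.differentiableAt.hasDerivAt.hasDerivWithinAt (s := 𝕀)).congr hF hF0
    rw [← h1.derivWithin (uniqueDiffOn_unit _ (hg hs))]
    exact (hα.trans_le (hlow _ (hg hs))).ne'
  have hinv := hFa.analyticAt_localInverse hder
  have hev := (hFa.hasStrictDerivAt.eventually_left_inverse hder)
  rw [← hF0, hfg hs] at hinv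
  refine analyticWithinAt_iff_exists_analyticAt.2 ⟨_, ?_, hinv⟩
  rw [insert_eq_of_mem hs]
  filter_upwards [hcont.tendsto.eventually hev, self_mem_nhdsWithin] with t ht ht'
  rw [← hF (hg ht'), hfg ht'] at ht
  exact ht.symm

lemma IsOfClass.inverse {r : Degree} (hf : IsOfClass r f) (hα : 0 < α)
    (hlow : ∀ t ∈ 𝕀, α ≤ derivWithin f 𝕀 t) (hg : MapsTo g 𝕀 𝕀) (hfg : RightInvOn g f 𝕀) :
    IsOfClass r g := by
  cases r with
  | holder k γ hk hγ₀ hγ₁ =>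
    rw [isOfClass_holder_iff] at hf ⊢
    obtain ⟨k, rfl⟩ := Nat.exists_eq_add_of_le' hk
    obtain ⟨K, hK⟩ := hf
    exact hK.inverse hγ₀ hγ₁ hα hlow hg hfg
  | smooth =>
    rw [isOfClass_smooth_iff] at hf ⊢
    intro k
    obtain ⟨K, hK⟩ := hf k
    exact hK.inverse one_pos le_rfl hα hlow hg hfg
  | analytic => exact analyticOn_inverse hf hα hlow hg hfg

end Inverse

/-! ### Bounded distortion -/

lemma wordMap_append (φ : Fin 2 → ℝ → ℝ) (v w : List (Fin 2)) (t : ℝ) :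
    wordMap φ (v ++ w) t = wordMap φ v (wordMap φ w t) := by
  induction v with
  | nil => rfl
  | cons i v ih => simp [wordMap, ih]

namespace IsHyperbolic

variable {r : Degree} {φ : Fin 2 → ℝ → ℝ}

lemma mapsTo_wordMap (hφ : IsHyperbolic r φ) (w : List (Fin 2)) : MapsTo (wordMap φ w) 𝕀 𝕀 := by
  induction w with
  | nil => exact mapsTo_id _
  | cons i w ih => exact (hφ.mapsTo i).comp ih

lemma hasDerivWithinAt_cons_of (hφ : IsHyperbolic r φ) {w : List (Fin 2)} {d t : ℝ}
    (ht : t ∈ 𝕀) (h : HasDerivWithinAt (wordMap φ w) d 𝕀 t) (i : Fin 2) :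
    HasDerivWithinAt (wordMap φ (i :: w)) (derivWithin (φ i) 𝕀 (wordMap φ w t) * d) 𝕀 t :=
  ((hφ.isOfClass i).hasDerivWithinAt (hφ.mapsTo_wordMap w ht)).comp t h (hφ.mapsTo_wordMap w)

lemma hasDerivWithinAt_wordMap (hφ : IsHyperbolic r φ) (w : List (Fin 2)) {t : ℝ} (ht : t ∈ 𝕀) :
    HasDerivWithinAt (wordMap φ w) (derivWithin (wordMap φ w) 𝕀 t) 𝕀 t := by
  induction w with
  | nil => exact (hasDerivWithinAt_id t 𝕀).differentiableWithinAt.hasDerivWithinAt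
  | cons i w ih =>
    exact (hφ.hasDerivWithinAt_cons_of ht ih i).differentiableWithinAt.hasDerivWithinAt

lemma derivWithin_nil {t : ℝ} (ht : t ∈ 𝕀) : derivWithin (wordMap φ []) 𝕀 t = 1 :=
  derivWithin_id _ _ (uniqueDiffOn_unit t ht)

lemma derivWithin_cons (hφ : IsHyperbolic r φ) (i : Fin 2) (w : List (Fin 2)) {t : ℝ}
    (ht : t ∈ 𝕀) : derivWithin (wordMap φ (i :: w)) 𝕀 t =
      derivWithin (φ i) 𝕀 (wordMap φ w t) * derivWithin (wordMap φ w) 𝕀 t :=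
  (hφ.hasDerivWithinAt_cons_of ht (hφ.hasDerivWithinAt_wordMap w ht) i).derivWithin
    (uniqueDiffOn_unit t ht)

lemma derivWithin_pos (hφ : IsHyperbolic r φ) (i : Fin 2) {t : ℝ} (ht : t ∈ 𝕀) :
    0 < derivWithin (φ i) 𝕀 t := by
  obtain ⟨α, hα, h⟩ := hφ.deriv_lower
  exact hα.trans (h i t ht)

lemma derivWithin_wordMap_pos (hφ : IsHyperbolic r φ) (w : List (Fin 2)) {t : ℝ} (ht : t ∈ 𝕀) :
    0 < derivWithin (wordMap φ w) 𝕀 t := by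
  induction w with
  | nil => rw [derivWithin_nil ht]; exact one_pos
  | cons i w ih =>
    rw [hφ.derivWithin_cons i w ht]
    exact mul_pos (hφ.derivWithin_pos i (hφ.mapsTo_wordMap w ht)) ih

lemma strictMonoOn_branch (hφ : IsHyperbolic r φ) (i : Fin 2) : StrictMonoOn (φ i) 𝕀 := by
  obtain ⟨α, hα, h⟩ := hφ.deriv_lower
  intro s hs t ht hst
  have := mul_sub_le_of_hasDerivWithinAt (fun t ht => (hφ.isOfClass i).hasDerivWithinAt ht)
    (fun t ht => (h i t ht).le) hs ht hst.le
  nlinarith [mul_pos hα (sub_pos.2 hst)]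

lemma strictMonoOn_wordMap (hφ : IsHyperbolic r φ) (w : List (Fin 2)) :
    StrictMonoOn (wordMap φ w) 𝕀 := by
  induction w with
  | nil => exact strictMonoOn_id
  | cons i w ih => exact (hφ.strictMonoOn_branch i).comp ih (hφ.mapsTo_wordMap w)

lemma wordMap_zero_lt_one (hφ : IsHyperbolic r φ) (w : List (Fin 2)) :
    wordMap φ w 0 < wordMap φ w 1 :=
  hφ.strictMonoOn_wordMap w zero_mem_unit one_mem_unit one_pos

lemma abs_wordMap_sub_le (hφ : IsHyperbolic r φ) {c β : ℝ} (hc : ∀ w : List (Fin 2), ∀ t ∈ 𝕀,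
      derivWithin (wordMap φ w) 𝕀 t < c * β ^ w.length) (w : List (Fin 2)) {s t : ℝ}
    (hs : s ∈ 𝕀) (ht : t ∈ 𝕀) :
    |wordMap φ w s - wordMap φ w t| ≤ c * β ^ w.length * |s - t| :=
  abs_sub_le_of_hasDerivWithinAt (fun _ ht => hφ.hasDerivWithinAt_wordMap w ht)
    (fun t ht => by
      rw [abs_of_pos (hφ.derivWithin_wordMap_pos w ht)]; exact (hc w t ht).le) hs ht

end IsHyperbolic

/-- The derivative of `φ_w`, divided by its value at the base point `x`. -/
noncomputable def distortion (φ : Fin 2 → ℝ → ℝ) (w : List (Fin 2)) (x t : ℝ) : ℝ :=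
  derivWithin (wordMap φ w) 𝕀 t / derivWithin (wordMap φ w) 𝕀 x

/-- The relative change of the distortion of `φ_w` on passing from `w` to `iw`. -/
noncomputable def distortionStep (φ : Fin 2 → ℝ → ℝ) (i : Fin 2) (w : List (Fin 2)) (x t : ℝ) :
    ℝ :=
  derivWithin (φ i) 𝕀 (wordMap φ w t) / derivWithin (φ i) 𝕀 (wordMap φ w x) - 1

namespace IsHyperbolic

variable {r : Degree} {φ : Fin 2 → ℝ → ℝ}

lemma distortion_cons (hφ : IsHyperbolic r φ) (i : Fin 2) (w : List (Fin 2)) {x t : ℝ}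
    (hx : x ∈ 𝕀) (ht : t ∈ 𝕀) : distortion φ (i :: w) x t =
      distortion φ w x t + distortion φ w x t * distortionStep φ i w x t := by
  simp only [distortion, distortionStep]
  rw [hφ.derivWithin_cons i w ht, hφ.derivWithin_cons i w hx]
  have h1 := (hφ.derivWithin_pos i (hφ.mapsTo_wordMap w hx)).ne'
  have h2 := (hφ.derivWithin_wordMap_pos w hx).ne'
  field_simp
  ring

lemma derivWithin_mul_distortion (hφ : IsHyperbolic r φ) (w : List (Fin 2)) {x : ℝ}
    (hx : x ∈ 𝕀) (t : ℝ) :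
    derivWithin (wordMap φ w) 𝕀 x * distortion φ w x t = derivWithin (wordMap φ w) 𝕀 t := by
  have h2 := (hφ.derivWithin_wordMap_pos w hx).ne'
  simp only [distortion]; field_simp

/-- Geometric decay of the relative changes makes the distortions bounded: they are products
`∏ (1 + ε_j)` with `∑ ‖ε_j‖` bounded. -/
lemma holderBound_distortion_of_step (hφ : IsHyperbolic r φ) {γ : ℝ} (hγ₁ : γ ≤ 1) {k : ℕ}
    {M b : ℝ} (hb₀ : 0 ≤ b) (hb₁ : b < 1) (hM : 0 ≤ M) {x : ℝ} (hx : x ∈ 𝕀)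
    (hstep : ∀ i w, HolderBound γ k (M * b ^ w.length) (distortionStep φ i w x))
    (w : List (Fin 2)) :
    HolderBound γ k (Real.exp (2 ^ (k + 1) * M * (1 - b)⁻¹)) (distortion φ w x) := by
  have main : HolderBound γ k
      (Real.exp (2 ^ (k + 1) * M * ∑ j ∈ Finset.range w.length, b ^ j)) (distortion φ w x) := by
    induction w with
    | nil =>
      refine ((HolderBound.const γ k 1).mono (by simp)).congr fun t ht => ?_
      simp [distortion, derivWithin_nil ht, derivWithin_nil hx]
    | cons i w ih =>
      refine ((ih.add (ih.mul hγ₁ (hstep i w))).mono ?_).congr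
        fun t ht => hφ.distortion_cons i w hx ht
      rw [List.length_cons, Finset.sum_range_succ, mul_add, Real.exp_add]
      have h1 := Real.add_one_le_exp (2 ^ (k + 1) * M * b ^ w.length)
      have h2 := mul_le_mul_of_nonneg_left h1
        (Real.exp_pos (2 ^ (k + 1) * M * ∑ j ∈ Finset.range w.length, b ^ j)).le
      linarith
  refine main.mono (Real.exp_le_exp.2 (mul_le_mul_of_nonneg_left ?_ (by positivity)))
  rw [← tsum_geometric_of_lt_one hb₀ hb₁]
  exact (summable_geometric_of_lt_one hb₀ hb₁).sum_le_tsum _ fun j _ => by positivity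

lemma holderBound_distortionStep_zero (hφ : IsHyperbolic r φ) {γ : ℝ} (hγ₀ : 0 < γ)
    {K α c β : ℝ} (hα : 0 < α) (hc₀ : 0 < c) (hβ₀ : 0 < β)
    (hlow : ∀ i, ∀ t ∈ 𝕀, α < derivWithin (φ i) 𝕀 t)
    (hc : ∀ w : List (Fin 2), ∀ t ∈ 𝕀, derivWithin (wordMap φ w) 𝕀 t < c * β ^ w.length)
    (hd : ∀ i, HolderBound γ 0 K (derivWithin (φ i) 𝕀)) (i : Fin 2) (w : List (Fin 2)) {x : ℝ}
    (hx : x ∈ 𝕀) :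
    HolderBound γ 0 (K * c ^ γ / α * (β ^ γ) ^ w.length) (distortionStep φ i w x) := by
  have hK : 0 ≤ K := (hd 0).nonneg
  have key : ∀ s ∈ 𝕀, ∀ t ∈ 𝕀,
      |derivWithin (φ i) 𝕀 (wordMap φ w s) / derivWithin (φ i) 𝕀 (wordMap φ w x) -
        derivWithin (φ i) 𝕀 (wordMap φ w t) / derivWithin (φ i) 𝕀 (wordMap φ w x)| ≤
      K * c ^ γ / α * (β ^ γ) ^ w.length * |s - t| ^ γ := by
    intro s hs t ht
    have hm := hφ.mapsTo_wordMap w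
    have hden := hlow i _ (hm hx)
    rw [← sub_div, abs_div, abs_of_pos (hα.trans hden)]
    have h1 := (hd i).2 _ (hm hs) _ (hm ht)
    have h2 := Real.rpow_le_rpow (abs_nonneg _) (hφ.abs_wordMap_sub_le hc w hs ht) hγ₀.le
    rw [Real.mul_rpow (by positivity) (abs_nonneg _), Real.mul_rpow hc₀.le (by positivity),
      ← Real.rpow_natCast β, ← Real.rpow_mul hβ₀.le, mul_comm (w.length : ℝ) γ,
      Real.rpow_mul hβ₀.le, Real.rpow_natCast] at h2
    calc _ ≤ K * (c ^ γ * (β ^ γ) ^ w.length * |s - t| ^ γ) / α :=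
          div_le_div₀ (by positivity) (h1.trans (mul_le_mul_of_nonneg_left h2 hK)) hα hden.le
      _ = _ := by ring
  refine ⟨fun t ht => ?_, fun s hs t ht => ?_⟩
  · have h1 := key t ht x hx
    rw [div_self (hφ.derivWithin_pos i (hφ.mapsTo_wordMap w hx)).ne'] at h1
    refine h1.trans (mul_le_of_le_one_right (by positivity) ?_)
    exact Real.rpow_le_one (abs_nonneg _) (abs_sub_le_one ht hx) hγ₀.le
  · simp only [distortionStep, sub_sub_sub_cancel_right]
    exact key s hs t ht

/-- Bounded distortion in the class `C^{k+γ}`, uniformly over all words and base points. -/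
theorem exists_distortion_bound (hφ : IsHyperbolic r φ) {γ : ℝ} (hγ₀ : 0 < γ) (hγ₁ : γ ≤ 1)
    {k : ℕ} (hd : ∀ i, ∃ K, HolderBound γ k K (derivWithin (φ i) 𝕀)) :
    ∃ b M B : ℝ, 0 ≤ b ∧ b < 1 ∧ 0 ≤ M ∧ ∀ x ∈ 𝕀, ∀ w,
      HolderBound γ k B (distortion φ w x) ∧
      ∀ i, HolderBound γ k (M * b ^ w.length) (distortionStep φ i w x) := by
  obtain ⟨α, hα, hlow⟩ := hφ.deriv_lower
  obtain ⟨c, β, hc₀, hβ₀, hβ₁, hc⟩ := hφ.deriv_upper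
  have hb₀ : 0 ≤ β ^ γ := by positivity
  have hb₁ : β ^ γ < 1 := Real.rpow_lt_one hβ₀.le hβ₁ hγ₀
  have hβb : β ≤ β ^ γ := by
    simpa using Real.rpow_le_rpow_of_exponent_ge hβ₀ hβ₁.le hγ₁
  suffices h : ∃ M, 0 ≤ M ∧ ∀ x ∈ 𝕀, ∀ i w,
      HolderBound γ k (M * (β ^ γ) ^ w.length) (distortionStep φ i w x) by
    obtain ⟨M, hM, h⟩ := h
    exact ⟨β ^ γ, M, _, hb₀, hb₁, hM, fun x hx w =>
      ⟨hφ.holderBound_distortion_of_step hγ₁ hb₀ hb₁ hM hx (h x hx) w, fun i => h x hx i w⟩⟩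
  have base : ∀ {K}, (∀ i, HolderBound γ 0 K (derivWithin (φ i) 𝕀)) → ∃ M, 0 ≤ M ∧ ∀ x ∈ 𝕀,
      ∀ i w, HolderBound γ 0 (M * (β ^ γ) ^ w.length) (distortionStep φ i w x) := by
    intro K hK
    have := (hK 0).nonneg
    exact ⟨K * c ^ γ / α, by positivity, fun x hx i w =>
      hφ.holderBound_distortionStep_zero hγ₀ hα hc₀ hβ₀ hlow hc hK i w hx⟩
  choose K₁ hK₁ using hd
  obtain ⟨K, hK⟩ : ∃ K, ∀ i, HolderBound γ k K (derivWithin (φ i) 𝕀) :=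
    ⟨max (K₁ 0) (K₁ 1), fun i => (hK₁ i).mono (by fin_cases i <;> simp)⟩
  clear hK₁
  induction k with
  | zero => exact base hK
  | succ k ih =>
    obtain ⟨M, hM, hstep⟩ := ih fun i => (hK i).pred hγ₁
    have hK0 : ∀ i, HolderBound γ 0 K (derivWithin (φ i) 𝕀) := fun i => by
      have : ∀ (n : ℕ) {f : ℝ → ℝ}, HolderBound γ n K f → HolderBound γ 0 K f := by
        intro n
        induction n with
        | zero => exact id
        | succ n ih => exact fun h => ih (h.pred hγ₁)
      exact this _ (hK i)
    obtain ⟨M₀, hM₀, hstep₀⟩ := base hK0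
    set B := Real.exp (2 ^ (k + 1) * M * (1 - β ^ γ)⁻¹) with hB
    have hE : ∀ x ∈ 𝕀, ∀ w, HolderBound γ k B (distortion φ w x) := fun x hx w =>
      hφ.holderBound_distortion_of_step hγ₁ hb₀ hb₁ hM hx (hstep x hx) w
    have hBpos : 0 < B := Real.exp_pos _
    -- `D φ_w = D φ_w(x) · E` is of size `c β^|w|` in `C^{k+γ}`, so the `φ_w` are bounded one
    -- order higher
    have hD : ∀ w, HolderBound γ k (2 ^ (k + 1) * (c * β ^ w.length) * B)
        (derivWithin (wordMap φ w) 𝕀) := fun w => by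
      refine (((hE 0 zero_mem_unit w).const_mul hγ₁ (derivWithin (wordMap φ w) 𝕀 0)).mono
        ?_).congr fun t _ => (hφ.derivWithin_mul_distortion w zero_mem_unit t).symm
      rw [abs_of_pos (hφ.derivWithin_wordMap_pos w zero_mem_unit)]
      have := (hc w 0 zero_mem_unit).le
      gcongr
    have hw : ∀ w, HolderBound γ (k + 1) (max 1 (2 ^ (k + 1) * c * B)) (wordMap φ w) := fun w => by
      refine ⟨fun t ht => ?_, _, fun t ht => hφ.hasDerivWithinAt_wordMap w ht,
        (hD w).mono (le_trans ?_ (le_max_right _ _))⟩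
      · have := hφ.mapsTo_wordMap w ht
        rw [abs_of_nonneg this.1]
        exact this.2.trans (le_max_left _ _)
      · have : β ^ w.length ≤ 1 := pow_le_one₀ hβ₀.le hβ₁.le
        have : c * β ^ w.length ≤ c := mul_le_of_le_one_right hc₀.le this
        gcongr
    choose d' hd' hd'' using fun i => (hK i).2
    obtain ⟨L, hL⟩ := HolderBound.comp_of_succ hγ₀ hγ₁ k K (max 1 (2 ^ (k + 1) * c * B))
    have hL0 : 0 ≤ L := (hL (d' 0) _ (hφ.mapsTo_wordMap []) (hd'' 0) (hw [])).nonneg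
    refine ⟨max M₀ (2 ^ (k + 1) * α⁻¹ * (2 ^ (k + 1) * L * (2 ^ (k + 1) * c * B))),
      le_max_of_le_left hM₀, fun x hx i w => ?_⟩
    refine ⟨fun t ht => ((hstep₀ x hx i w).1 t ht).trans
      (mul_le_mul_of_nonneg_right (le_max_left _ _) (by positivity)),
      fun t => (derivWithin (φ i) 𝕀 (wordMap φ w x))⁻¹ *
        (d' i (wordMap φ w t) * derivWithin (wordMap φ w) 𝕀 t), fun t ht => ?_, ?_⟩
    · have h1 := (hd' i _ (hφ.mapsTo_wordMap w ht)).comp t (hφ.hasDerivWithinAt_wordMap w ht)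
        (hφ.mapsTo_wordMap w)
      refine ((h1.div_const (derivWithin (φ i) 𝕀 (wordMap φ w x))).sub_const 1).congr_deriv ?_
      rw [div_eq_inv_mul]
    · refine (((hL _ _ (hφ.mapsTo_wordMap w) (hd'' i) (hw w)).mul hγ₁ (hD w)).const_mul hγ₁
        _).mono ?_
      have h1 := hlow i _ (hφ.mapsTo_wordMap w hx)
      rw [abs_inv, abs_of_pos (hα.trans h1)]
      have h2 : (derivWithin (φ i) 𝕀 (wordMap φ w x))⁻¹ ≤ α⁻¹ := inv_anti₀ hα h1.le
      have h3 : β ^ w.length ≤ (β ^ γ) ^ w.length := pow_le_pow_left₀ hβ₀.le hβb _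
      calc _ ≤ 2 ^ (k + 1) * α⁻¹ * (2 ^ (k + 1) * L *
            (2 ^ (k + 1) * (c * (β ^ γ) ^ w.length) * B)) := by gcongr
        _ = 2 ^ (k + 1) * α⁻¹ * (2 ^ (k + 1) * L * (2 ^ (k + 1) * c * B)) *
            (β ^ γ) ^ w.length := by ring
        _ ≤ _ := mul_le_mul_of_nonneg_right (le_max_right _ _) (by positivity)

end IsHyperbolic

/-! ### Convergence of the normalized branches -/

lemma length_pastWord (y : Past) (n : ℕ) : (pastWord y n).length = n := by
  induction n with
  | zero => rfl
  | succ n ih => simp [pastWord, ih]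

/-- The branch `φ_w`, normalized to have value `0` and derivative `1` at `x`. -/
noncomputable def linearized (φ : Fin 2 → ℝ → ℝ) (w : List (Fin 2)) (x t : ℝ) : ℝ :=
  (wordMap φ w t - wordMap φ w x) / derivWithin (wordMap φ w) 𝕀 x

/-- The limit of the linearized branches along the words `y_{-n} … y_{-1}`, as a telescoping
series. -/
noncomputable def linearizedLimit (φ : Fin 2 → ℝ → ℝ) (y : Past) (x t : ℝ) : ℝ :=
  linearized φ [] x t +
    ∑' n, (linearized φ (pastWord y (n + 1)) x t - linearized φ (pastWord y n) x t)

/-- The branch `φ_w`, affinely normalized to fix `0` and `1`. -/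
noncomputable def normalized (φ : Fin 2 → ℝ → ℝ) (w : List (Fin 2)) (t : ℝ) : ℝ :=
  (wordMap φ w t - wordMap φ w 0) / (wordMap φ w 1 - wordMap φ w 0)

/-- The limit of the normalized branches `φ_w`, `w = y_{-n} … y_{-1}`. It carries the Cantor set
to its limit set at `y`. -/
noncomputable def limitMap (φ : Fin 2 → ℝ → ℝ) (y : Past) (t : ℝ) : ℝ :=
  linearizedLimit φ y 0 t / linearizedLimit φ y 0 1

namespace IsHyperbolic

variable {r : Degree} {φ : Fin 2 → ℝ → ℝ}

lemma hasDerivWithinAt_linearized (hφ : IsHyperbolic r φ) (w : List (Fin 2)) (x : ℝ) {t : ℝ}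
    (ht : t ∈ 𝕀) : HasDerivWithinAt (linearized φ w x) (distortion φ w x t) 𝕀 t :=
  ((hφ.hasDerivWithinAt_wordMap w ht).sub_const _).div_const _

lemma exists_holderBound_derivWithin (hφ : IsHyperbolic r φ) (i : Fin 2) :
    ∃ K, HolderBound r.exponent 0 K (derivWithin (φ i) 𝕀) := by
  obtain ⟨K, -, f', hf', h1⟩ := (hφ.isOfClass i).exists_holderBound
  exact ⟨K, h1.congr fun t ht => (hf' t ht).derivWithin (uniqueDiffOn_unit t ht)⟩

lemma exists_holderBound_linearized_sub (hφ : IsHyperbolic r φ) {γ : ℝ} (hγ₀ : 0 < γ)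
    (hγ₁ : γ ≤ 1) {k : ℕ} (hd : ∀ i, ∃ K, HolderBound γ k K (derivWithin (φ i) 𝕀)) :
    ∃ Q b : ℝ, 0 ≤ b ∧ b < 1 ∧ ∀ x ∈ 𝕀, ∀ (i : Fin 2) (w : List (Fin 2)),
      HolderBound γ (k + 1) (Q * b ^ w.length)
        (fun t => linearized φ (i :: w) x t - linearized φ w x t) := by
  obtain ⟨b, M, B, hb₀, hb₁, hM, h⟩ := hφ.exists_distortion_bound hγ₀ hγ₁ hd
  refine ⟨2 ^ (k + 1) * B * M, b, hb₀, hb₁, fun x hx i w => ?_⟩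
  obtain ⟨h1, h2⟩ := h x hx w
  have h3 : HolderBound γ k (2 ^ (k + 1) * B * M * b ^ w.length)
      (fun t => distortion φ w x t * distortionStep φ i w x t) :=
    (h1.mul hγ₁ (h2 i)).mono (le_of_eq (by ring))
  have hder : ∀ t ∈ 𝕀, HasDerivWithinAt
      (fun t => linearized φ (i :: w) x t - linearized φ w x t)
      (distortion φ w x t * distortionStep φ i w x t) 𝕀 t := fun t ht => by
    refine ((hφ.hasDerivWithinAt_linearized (i :: w) x ht).sub
      (hφ.hasDerivWithinAt_linearized w x ht)).congr_deriv ?_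
    rw [hφ.distortion_cons i w hx ht]; ring
  refine ⟨fun t ht => ?_, _, hder, h3⟩
  have h4 := abs_sub_le_of_hasDerivWithinAt hder (fun t ht => h3.abs_le ht) ht hx
  simp only [linearized, sub_self, zero_div, sub_zero] at h4
  exact h4.trans (mul_le_of_le_one_right h3.nonneg (abs_sub_le_one ht hx))

/-- The linearized branches converge geometrically fast, uniformly in the base point. -/
lemma exists_linearized_sub_limit_le (hφ : IsHyperbolic r φ) (y : Past) :
    ∃ Q b : ℝ, 0 ≤ b ∧ b < 1 ∧ ∀ x ∈ 𝕀, ∀ t ∈ 𝕀, ∀ n,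
      |linearized φ (pastWord y n) x t - linearizedLimit φ y x t| ≤ Q * b ^ n := by
  obtain ⟨Q, b, hb₀, hb₁, h⟩ := hφ.exists_holderBound_linearized_sub r.exponent_pos
    r.exponent_le_one hφ.exists_holderBound_derivWithin
  refine ⟨Q / (1 - b), b, hb₀, hb₁, fun x hx t ht n => ?_⟩
  have hstep : ∀ n, |linearized φ (pastWord y (n + 1)) x t - linearized φ (pastWord y n) x t| ≤
      Q * b ^ n := fun n => by
    have := (h x hx (y n) (pastWord y n)).abs_le ht
    rwa [length_pastWord] at this
  have hsum : Summable fun n =>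
      linearized φ (pastWord y (n + 1)) x t - linearized φ (pastWord y n) x t :=
    Summable.of_norm_bounded ((summable_geometric_of_lt_one hb₀ hb₁).mul_left Q) hstep
  have hlim : Tendsto (fun n => linearized φ (pastWord y n) x t) atTop
      (𝓝 (linearizedLimit φ y x t)) := by
    have h1 := hsum.hasSum.tendsto_sum_nat.const_add (linearized φ [] x t)
    refine h1.congr fun n => ?_
    rw [Finset.sum_range_sub fun n => linearized φ (pastWord y n) x t]
    simp [pastWord]
  have h2 := dist_le_of_le_geometric_of_tendsto b Q hb₁ (fun n => by
    rw [dist_comm, Real.dist_eq]; exact hstep n) hlim n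
  rw [Real.dist_eq] at h2
  exact h2.trans (le_of_eq (by ring))

lemma tendsto_linearized (hφ : IsHyperbolic r φ) (y : Past) {x t : ℝ} (hx : x ∈ 𝕀)
    (ht : t ∈ 𝕀) : Tendsto (fun n => linearized φ (pastWord y n) x t) atTop
      (𝓝 (linearizedLimit φ y x t)) := by
  obtain ⟨Q, b, hb₀, hb₁, h⟩ := hφ.exists_linearized_sub_limit_le y
  rw [tendsto_iff_norm_sub_tendsto_zero]
  refine squeeze_zero (fun _ => norm_nonneg _) (h x hx t ht) ?_
  simpa using (tendsto_pow_atTop_nhds_zero_of_lt_one hb₀ hb₁).const_mul Q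

lemma exists_holderBound_linearizedLimit (hφ : IsHyperbolic r φ) {γ : ℝ} (hγ₀ : 0 < γ)
    (hγ₁ : γ ≤ 1) {k : ℕ} (hd : ∀ i, ∃ K, HolderBound γ k K (derivWithin (φ i) 𝕀)) (y : Past)
    {x : ℝ} (hx : x ∈ 𝕀) : ∃ K, HolderBound γ (k + 1) K (linearizedLimit φ y x) := by
  obtain ⟨Q, b, hb₀, hb₁, h⟩ := hφ.exists_holderBound_linearized_sub hγ₀ hγ₁ hd
  have h1 := HolderBound.tsum hγ₀ (fun n => h x hx (y n) (pastWord y n))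
    (by simpa only [length_pastWord] using (summable_geometric_of_lt_one hb₀ hb₁).mul_left Q)
  have h2 : HolderBound γ (k + 1) 1 (linearized φ [] x) := by
    refine ⟨fun t ht => ?_, fun _ => 1, fun t ht => ?_, (HolderBound.const γ k 1).mono (by simp)⟩
    · rw [linearized, derivWithin_nil hx, div_one]
      exact abs_sub_le_one ht hx
    · refine (hφ.hasDerivWithinAt_linearized [] x ht).congr_deriv ?_
      simp [distortion, derivWithin_nil hx, derivWithin_nil ht]
  exact ⟨_, h2.add h1⟩

/-- Bounded distortion from below. Exchanging the base point and the argument inverts the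
distortion, so that an upper bound is also a lower bound. -/
lemma exists_mul_sub_le_linearized (hφ : IsHyperbolic r φ) :
    ∃ a : ℝ, 0 < a ∧ ∀ x ∈ 𝕀, ∀ s ∈ 𝕀, ∀ t ∈ 𝕀, s ≤ t → ∀ w,
      a * (t - s) ≤ linearized φ w x t - linearized φ w x s := by
  obtain ⟨b, M, B, -, -, -, h⟩ := hφ.exists_distortion_bound r.exponent_pos
    r.exponent_le_one hφ.exists_holderBound_derivWithin
  have hpos : ∀ w, ∀ x ∈ 𝕀, ∀ t ∈ 𝕀, 0 < distortion φ w x t := fun w x hx t ht =>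
    div_pos (hφ.derivWithin_wordMap_pos w ht) (hφ.derivWithin_wordMap_pos w hx)
  have hle : ∀ w, ∀ x ∈ 𝕀, ∀ t ∈ 𝕀, distortion φ w x t ≤ B := fun w x hx t ht =>
    (le_abs_self _).trans ((h x hx w).1.abs_le ht)
  have hB : 0 < B := (hpos [] 0 zero_mem_unit 0 zero_mem_unit).trans_le
    (hle [] 0 zero_mem_unit 0 zero_mem_unit)
  refine ⟨B⁻¹, inv_pos.2 hB, fun x hx s hs t ht hst w => ?_⟩
  refine mul_sub_le_of_hasDerivWithinAt (fun t ht => hφ.hasDerivWithinAt_linearized w x ht)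
    (fun t ht => ?_) hs ht hst
  have : distortion φ w x t = (distortion φ w t x)⁻¹ := by simp [distortion]
  rw [this]
  exact inv_anti₀ (hpos w t ht x hx) (hle w t ht x hx)

lemma exists_mul_sub_le_linearizedLimit (hφ : IsHyperbolic r φ) (y : Past) :
    ∃ a : ℝ, 0 < a ∧ ∀ x ∈ 𝕀, ∀ s ∈ 𝕀, ∀ t ∈ 𝕀, s ≤ t →
      a * (t - s) ≤ linearizedLimit φ y x t - linearizedLimit φ y x s := by
  obtain ⟨a, ha, h⟩ := hφ.exists_mul_sub_le_linearized
  exact ⟨a, ha, fun x hx s hs t ht hst => ge_of_tendsto'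
    ((hφ.tendsto_linearized y hx ht).sub (hφ.tendsto_linearized y hx hs))
    fun n => h x hx s hs t ht hst _⟩

lemma normalized_eq (hφ : IsHyperbolic r φ) (w : List (Fin 2)) {x : ℝ} (hx : x ∈ 𝕀) (t : ℝ) :
    normalized φ w t = (linearized φ w x t - linearized φ w x 0) /
      (linearized φ w x 1 - linearized φ w x 0) := by
  simp only [normalized, linearized]
  have h1 := (hφ.derivWithin_wordMap_pos w hx).ne'
  rw [← sub_div, ← sub_div, div_div_div_cancel_right₀ h1, sub_sub_sub_cancel_right,
    sub_sub_sub_cancel_right]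

lemma linearized_self (w : List (Fin 2)) (x : ℝ) : linearized φ w x x = 0 := by
  simp [linearized]

lemma linearizedLimit_self (hφ : IsHyperbolic r φ) (y : Past) {x : ℝ} (hx : x ∈ 𝕀) :
    linearizedLimit φ y x x = 0 :=
  tendsto_nhds_unique (hφ.tendsto_linearized y hx hx) (by simp [linearized_self])

/-- The normalized branches converge geometrically fast, uniformly on `[0,1]`. -/
lemma exists_normalized_sub_limitMap_le (hφ : IsHyperbolic r φ) (y : Past) :
    ∃ Q b : ℝ, 0 ≤ b ∧ b < 1 ∧ ∀ t ∈ 𝕀, ∀ n,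
      |normalized φ (pastWord y n) t - limitMap φ y t| ≤ Q * b ^ n := by
  obtain ⟨Q, b, hb₀, hb₁, h⟩ := hφ.exists_linearized_sub_limit_le y
  obtain ⟨a, ha, hlow⟩ := hφ.exists_mul_sub_le_linearized
  obtain ⟨a', ha', hlow'⟩ := hφ.exists_mul_sub_le_linearizedLimit y
  refine ⟨2 * Q / a, b, hb₀, hb₁, fun t ht n => ?_⟩
  have h0 := zero_mem_unit
  have hN1 := hlow 0 h0 0 h0 1 one_mem_unit zero_le_one (pastWord y n)
  have hL1 := hlow' 0 h0 0 h0 1 one_mem_unit zero_le_one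
  have hLt := hlow' 0 h0 0 h0 t ht ht.1
  have hL2 := hlow' 0 h0 t ht 1 one_mem_unit ht.2
  have e1 := h 0 h0 t ht n
  have e2 := h 0 h0 1 one_mem_unit n
  have hn0 : linearized φ (pastWord y n) 0 0 = 0 := linearized_self _ _
  rw [hφ.normalized_eq _ h0, limitMap, hn0]
  rw [hn0] at hN1
  rw [hφ.linearizedLimit_self y h0] at hL1 hLt
  have hQ : 0 ≤ Q * b ^ n := (abs_nonneg _).trans e1
  set p := linearized φ (pastWord y n) 0 t
  set q := linearized φ (pastWord y n) 0 1
  set P := linearizedLimit φ y 0 t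
  set R := linearizedLimit φ y 0 1
  simp only [sub_zero, mul_one] at hN1 hL1 hLt ⊢
  have hq : 0 < q := ha.trans_le hN1
  have hR : 0 < R := ha'.trans_le hL1
  have hP : 0 ≤ P := (mul_nonneg ha'.le ht.1).trans hLt
  have hPR : P / R ≤ 1 := by
    rw [div_le_one hR]; nlinarith [ht.2]
  have e : p / q - P / R = ((p - P) - P / R * (q - R)) / q := by field_simp; ring
  rw [e, abs_div, abs_of_pos hq]
  have hPR0 : 0 ≤ P / R := div_nonneg hP hR.le
  have h3 : |(p - P) - P / R * (q - R)| ≤ 2 * Q * b ^ n := by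
    have h4 : |P / R * (q - R)| ≤ 1 * (Q * b ^ n) := by
      rw [abs_mul, abs_of_nonneg hPR0]
      exact mul_le_mul hPR e2 (abs_nonneg _) zero_le_one
    have h5 := abs_sub (p - P) (P / R * (q - R))
    linarith
  calc _ ≤ 2 * Q * b ^ n / a := div_le_div₀ (by linarith) h3 ha hN1
    _ = _ := by ring

lemma tendsto_normalized (hφ : IsHyperbolic r φ) (y : Past) {t : ℝ} (ht : t ∈ 𝕀) :
    Tendsto (fun n => normalized φ (pastWord y n) t) atTop (𝓝 (limitMap φ y t)) := by
  obtain ⟨Q, b, hb₀, hb₁, h⟩ := hφ.exists_normalized_sub_limitMap_le y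
  rw [tendsto_iff_norm_sub_tendsto_zero]
  refine squeeze_zero (fun _ => norm_nonneg _) (h t ht) ?_
  simpa using (tendsto_pow_atTop_nhds_zero_of_lt_one hb₀ hb₁).const_mul Q

lemma linearizedLimit_zero_lt_one (hφ : IsHyperbolic r φ) (y : Past) {x : ℝ} (hx : x ∈ 𝕀) :
    linearizedLimit φ y x 0 < linearizedLimit φ y x 1 := by
  obtain ⟨a, ha, h⟩ := hφ.exists_mul_sub_le_linearizedLimit y
  have := h x hx 0 zero_mem_unit 1 one_mem_unit zero_le_one
  linarith

/-- Up to an affine change of coordinate, the linearized limit does not depend on the base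
point. -/
lemma limitMap_eq (hφ : IsHyperbolic r φ) (y : Past) {x t : ℝ} (hx : x ∈ 𝕀) (ht : t ∈ 𝕀) :
    limitMap φ y t = (linearizedLimit φ y x t - linearizedLimit φ y x 0) /
      (linearizedLimit φ y x 1 - linearizedLimit φ y x 0) := by
  refine tendsto_nhds_unique (hφ.tendsto_normalized y ht) ?_
  simp only [fun n => hφ.normalized_eq (pastWord y n) hx t]
  have h0 := hφ.tendsto_linearized y hx zero_mem_unit
  exact ((hφ.tendsto_linearized y hx ht).sub h0).div
    ((hφ.tendsto_linearized y hx one_mem_unit).sub h0)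
    (sub_pos.2 (hφ.linearizedLimit_zero_lt_one y hx)).ne'

lemma limitMap_zero (hφ : IsHyperbolic r φ) (y : Past) : limitMap φ y 0 = 0 := by
  rw [hφ.limitMap_eq y zero_mem_unit zero_mem_unit, sub_self, zero_div]

lemma limitMap_one (hφ : IsHyperbolic r φ) (y : Past) : limitMap φ y 1 = 1 := by
  rw [hφ.limitMap_eq y zero_mem_unit one_mem_unit,
    div_self (sub_pos.2 (hφ.linearizedLimit_zero_lt_one y zero_mem_unit)).ne']

lemma exists_mul_sub_le_limitMap (hφ : IsHyperbolic r φ) (y : Past) :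
    ∃ a : ℝ, 0 < a ∧ ∀ s ∈ 𝕀, ∀ t ∈ 𝕀, s ≤ t →
      a * (t - s) ≤ limitMap φ y t - limitMap φ y s := by
  obtain ⟨a, ha, h⟩ := hφ.exists_mul_sub_le_linearizedLimit y
  have h0 := hφ.linearizedLimit_zero_lt_one y zero_mem_unit
  rw [hφ.linearizedLimit_self y zero_mem_unit] at h0
  refine ⟨a / linearizedLimit φ y 0 1, div_pos ha h0, fun s hs t ht hst => ?_⟩
  rw [limitMap, limitMap, ← sub_div, div_mul_eq_mul_div]
  exact div_le_div_of_nonneg_right (h 0 zero_mem_unit s hs t ht hst) h0.le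

lemma strictMonoOn_limitMap (hφ : IsHyperbolic r φ) (y : Past) :
    StrictMonoOn (limitMap φ y) 𝕀 := by
  obtain ⟨a, ha, h⟩ := hφ.exists_mul_sub_le_limitMap y
  intro s hs t ht hst
  have := h s hs t ht hst.le
  nlinarith [mul_pos ha (sub_pos.2 hst)]

lemma exists_holderBound_limitMap (hφ : IsHyperbolic r φ) {γ : ℝ} (hγ₀ : 0 < γ)
    (hγ₁ : γ ≤ 1) {k : ℕ} (hk : ∀ i, ∃ K, HolderBound γ (k + 1) K (φ i)) (y : Past) :
    ∃ K, HolderBound γ (k + 1) K (limitMap φ y) := by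
  obtain ⟨K, hK⟩ := hφ.exists_holderBound_linearizedLimit hγ₀ hγ₁ (k := k) (fun i => by
    obtain ⟨K, -, f', hf', h1⟩ := hk i
    exact ⟨K, h1.congr fun t ht => (hf' t ht).derivWithin (uniqueDiffOn_unit t ht)⟩) y
    zero_mem_unit
  refine ⟨_, (hK.const_mul hγ₁ (linearizedLimit φ y 0 1)⁻¹).congr fun t ht => ?_⟩
  rw [limitMap, div_eq_inv_mul]

end IsHyperbolic

/-! ### Real analytic branches -/

/-- A real analytic function extends to a holomorphic one near each point: the complex power series
with the same coefficients. -/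
lemma exists_holomorphic_extension {f : ℝ → ℝ} {s : Set ℝ} {q : ℝ}
    (hf : AnalyticWithinAt ℝ f s q) : ∃ ρ : ℝ, 0 < ρ ∧ ∃ G : ℂ → ℂ,
      DifferentiableOn ℂ G (Metric.ball (q : ℂ) ρ) ∧ ∀ t ∈ s, |t - q| < ρ → G t = f t := by
  obtain ⟨p, R, hp⟩ := hf
  obtain ⟨ρ, hρ₀, hρR⟩ := ENNReal.lt_iff_exists_nnreal_btwn.1 hp.r_pos
  set P : FormalMultilinearSeries ℂ ℂ ℂ :=
    FormalMultilinearSeries.ofScalars ℂ fun n => ((p.coeff n : ℝ) : ℂ) with hP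
  have hrad : p.radius ≤ P.radius := FormalMultilinearSeries.radius_le_of_le fun n => by
    rw [hP, FormalMultilinearSeries.ofScalars_norm, Complex.norm_real,
      FormalMultilinearSeries.norm_apply_eq_norm_coef]
  have hρP : (ρ : ENNReal) ≤ P.radius := hρR.le.trans (hp.r_le.trans hrad)
  have hball := (P.hasFPowerSeriesOnBall ((hp.r_pos.trans_le hp.r_le).trans_le hrad))
  refine ⟨ρ, by exact_mod_cast hρ₀, fun z => P.sum (z - q), ?_, fun t ht htq => ?_⟩
  · refine hball.differentiableOn.comp (differentiableOn_id.sub_const _) fun z hz => ?_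
    rw [Metric.mem_ball, dist_eq_norm] at hz
    rw [Metric.mem_eball, edist_zero_right]
    refine lt_of_lt_of_le ?_ hρP
    rw [enorm_eq_nnnorm]
    exact_mod_cast hz
  · have hmem : t - q ∈ Metric.eball (0 : ℝ) R := by
      rw [Metric.mem_eball, edist_zero_right]
      refine lt_trans ?_ hρR
      rw [enorm_eq_nnnorm]
      exact_mod_cast htq
    have h1 := hp.hasSum (y := t - q) (by simp [ht]) hmem
    rw [add_sub_cancel] at h1
    have h2 : HasSum (fun n => P n fun _ => ((t : ℂ) - q)) (P.sum (t - q)) := by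
      refine P.hasSum ?_
      rw [Metric.mem_eball, edist_zero_right] at hmem ⊢
      refine lt_of_lt_of_le ?_ (hp.r_le.trans hrad)
      have e : ‖((t : ℂ) - q)‖ₑ = ‖t - q‖ₑ := by
        rw [← Complex.ofReal_sub, enorm_eq_nnnorm, enorm_eq_nnnorm, Complex.nnnorm_real]
      rwa [e]
    refine h2.unique ((Complex.hasSum_ofReal.2 h1).congr_fun ?_)
    intro n
    rw [hP, FormalMultilinearSeries.ofScalars_apply_eq,
      FormalMultilinearSeries.apply_eq_pow_smul_coeff]
    push_cast [smul_eq_mul]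
    ring

/-- A real analytic function on `[0,1]` extends holomorphically to discs of uniform radius, with a
uniform Lipschitz bound for the derivatives. -/
lemma exists_uniform_holomorphic_extension {f : ℝ → ℝ} (hf : AnalyticOn ℝ f 𝕀) :
    ∃ δ K : ℝ, 0 < δ ∧ 0 ≤ K ∧ ∀ p ∈ 𝕀, ∃ G : ℂ → ℂ,
      DifferentiableOn ℂ G (Metric.ball (p : ℂ) δ) ∧ (∀ t ∈ 𝕀, |t - p| < δ → G t = f t) ∧
      ∀ z ∈ Metric.ball (p : ℂ) δ, ‖deriv G z - deriv G p‖ ≤ K * ‖z - p‖ := by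
  refine isCompact_Icc.induction_on (p := fun s : Set ℝ => ∃ δ K : ℝ, 0 < δ ∧ 0 ≤ K ∧ ∀ p ∈ s,
    ∃ G : ℂ → ℂ, DifferentiableOn ℂ G (Metric.ball (p : ℂ) δ) ∧
      (∀ t ∈ 𝕀, |t - p| < δ → G t = f t) ∧
      ∀ z ∈ Metric.ball (p : ℂ) δ, ‖deriv G z - deriv G p‖ ≤ K * ‖z - p‖)
    ⟨1, 0, one_pos, le_rfl, fun p hp => hp.elim⟩ ?_ ?_ ?_
  · rintro s t hst ⟨δ, K, hδ, hK, h⟩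
    exact ⟨δ, K, hδ, hK, fun p hp => h p (hst hp)⟩
  · rintro s t ⟨δ, K, hδ, hK, h⟩ ⟨δ', K', hδ', hK', h'⟩
    refine ⟨min δ δ', max K K', lt_min hδ hδ', le_max_of_le_left hK, fun p hp => ?_⟩
    rcases hp with hp | hp
    · obtain ⟨G, h1, h2, h3⟩ := h p hp
      exact ⟨G, h1.mono (Metric.ball_subset_ball (min_le_left _ _)),
        fun t ht htp => h2 t ht (htp.trans_le (min_le_left _ _)),
        fun z hz => (h3 z (Metric.ball_subset_ball (min_le_left _ _) hz)).trans
          (mul_le_mul_of_nonneg_right (le_max_left _ _) (norm_nonneg _))⟩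
    · obtain ⟨G, h1, h2, h3⟩ := h' p hp
      exact ⟨G, h1.mono (Metric.ball_subset_ball (min_le_right _ _)),
        fun t ht htp => h2 t ht (htp.trans_le (min_le_right _ _)),
        fun z hz => (h3 z (Metric.ball_subset_ball (min_le_right _ _) hz)).trans
          (mul_le_mul_of_nonneg_right (le_max_right _ _) (norm_nonneg _))⟩
  · intro q hq
    obtain ⟨ρ, hρ, G, hG, hGf⟩ := exists_holomorphic_extension (hf q hq)
    have hG1 := hG.deriv Metric.isOpen_ball
    have hG2 := hG1.deriv Metric.isOpen_ball
    have hsub : Metric.closedBall (q : ℂ) (ρ / 2) ⊆ Metric.ball (q : ℂ) ρ :=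
      Metric.closedBall_subset_ball (by linarith)
    obtain ⟨K, hK⟩ := (isCompact_closedBall (q : ℂ) (ρ / 2)).exists_bound_of_continuousOn
      (hG2.continuousOn.mono hsub)
    have hK0 : 0 ≤ K := (norm_nonneg _).trans (hK q (Metric.mem_closedBall_self (by linarith)))
    refine ⟨Metric.ball q (ρ / 4), mem_nhdsWithin_of_mem_nhds (Metric.ball_mem_nhds _ (by linarith)),
      ρ / 4, K, by linarith, hK0, fun p hp => ?_⟩
    have hp' : dist (p : ℂ) q < ρ / 4 := by
      rw [Complex.dist_eq, ← Complex.ofReal_sub, Complex.norm_real]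
      exact hp
    have hb : Metric.ball (p : ℂ) (ρ / 4) ⊆ Metric.closedBall (q : ℂ) (ρ / 2) := fun z hz => by
      rw [Metric.mem_closedBall]
      rw [Metric.mem_ball] at hz
      linarith [dist_triangle z p q]
    refine ⟨G, hG.mono (hb.trans hsub), fun t ht htp => hGf t ht ?_, fun z hz => ?_⟩
    · rw [Metric.mem_ball, Real.dist_eq] at hp
      linarith [abs_sub_le t p q]
    · exact (convex_closedBall (q : ℂ) (ρ / 2)).norm_image_sub_le_of_norm_deriv_le
        (fun w hw => hG1.differentiableAt (Metric.isOpen_ball.mem_nhds (hsub hw))) hK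
        (hb (Metric.mem_ball_self (by linarith))) (hb hz)

/-- The compositions `g_{n-1} ∘ ⋯ ∘ g_0`. -/
def iterates (g : ℕ → ℂ → ℂ) : ℕ → ℂ → ℂ
  | 0 => id
  | n + 1 => fun z => g n (iterates g n z)

/-- Holomorphic distortion: on a disc small enough that `∑ ‖Z_n(z) - p_n‖` stays small, the
iterates `Z_n = g_{n-1} ∘ ⋯ ∘ g_0` of the maps `g_n`, defined near the points `p_n` of an orbit,
contract like their derivatives `D_n` at the centre, and `(Z_n - p_n) / D_n` converges. -/
lemma exists_holomorphic_limit {g : ℕ → ℂ → ℂ} {p d D : ℕ → ℂ} {δ K α c β : ℝ} (hδ : 0 < δ)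
    (hK : 0 ≤ K) (hα : 0 < α) (hc : 0 < c) (hβ₀ : 0 < β) (hβ₁ : β < 1)
    (hg : ∀ n, DifferentiableOn ℂ (g n) (Metric.ball (p n) δ))
    (hgp : ∀ n, g n (p n) = p (n + 1))
    (hd : ∀ n, ∀ z ∈ Metric.ball (p n) δ, ‖deriv (g n) z - d n‖ ≤ K * ‖z - p n‖)
    (hdα : ∀ n, α ≤ ‖d n‖) (hD₀ : D 0 = 1) (hD : ∀ n, D (n + 1) = d n * D n)
    (hDc : ∀ n, ‖D n‖ ≤ c * β ^ n) :
    ∃ ρ : ℝ, 0 < ρ ∧ ∃ N : ℂ → ℂ, DifferentiableOn ℂ N (Metric.ball (p 0) ρ) ∧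
      ∀ z ∈ Metric.ball (p 0) ρ, (∀ n, iterates g n z ∈ Metric.ball (p n) δ) ∧
        Tendsto (fun n => (iterates g n z - p n) / D n) atTop (𝓝 (N z)) := by
  have hβ' : 0 < 1 - β := sub_pos.2 hβ₁
  have hlog : 0 < Real.log 2 := Real.log_pos one_lt_two
  set ρ := min (δ / (2 * c)) (Real.log 2 * α * (1 - β) / (2 * c * K + 1)) with hρ_def
  have hρ : 0 < ρ := lt_min (by positivity) (by positivity)
  set A := 2 * c * K * ρ / α with hA_def
  have hA : 0 ≤ A := by positivity
  have hAlog : A * (1 - β)⁻¹ ≤ Real.log 2 := by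
    have h1 : ρ * (2 * c * K + 1) ≤ Real.log 2 * α * (1 - β) :=
      (le_div_iff₀ (by positivity)).1 (min_le_right _ _)
    rw [← div_eq_mul_inv, div_le_iff₀ hβ', hA_def, div_le_iff₀ hα]
    nlinarith
  have hexp : ∀ n, Real.exp (A * ∑ j ∈ Finset.range n, β ^ j) ≤ 2 := fun n => by
    rw [← Real.exp_log two_pos]
    refine Real.exp_le_exp.2 (le_trans (mul_le_mul_of_nonneg_left ?_ hA) hAlog)
    rw [← tsum_geometric_of_lt_one hβ₀.le hβ₁]
    exact (summable_geometric_of_lt_one hβ₀.le hβ₁).sum_le_tsum _ fun j _ => by positivity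
  have hDn : ∀ n, D n ≠ 0 := fun n => by
    induction n with
    | zero => simp [hD₀]
    | succ n ih =>
      rw [hD]
      exact mul_ne_zero (norm_pos_iff.1 (hα.trans_le (hdα n))) ih
  have hZp : ∀ n, iterates g n (p 0) = p n := fun n => by
    induction n with
    | zero => rfl
    | succ n ih => simp only [iterates, ih, hgp]
  set U := Metric.ball (p 0) ρ
  have hU : IsOpen U := Metric.isOpen_ball
  have hp0 : p 0 ∈ U := Metric.mem_ball_self hρ
  have hUρ : ∀ z ∈ U, ‖z - p 0‖ < ρ := fun z hz => by rwa [← dist_eq_norm]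
  -- a derivative bound for `Z_n` confines `Z_n` to a disc of radius `2 c β^n ρ` about `p_n`
  have dist_of : ∀ n, DifferentiableOn ℂ (iterates g n) U →
      (∀ z ∈ U, ‖deriv (iterates g n) z‖ ≤ 2 * (c * β ^ n)) →
      ∀ z ∈ U, ‖iterates g n z - p n‖ ≤ 2 * c * ρ * β ^ n ∧
        iterates g n z ∈ Metric.ball (p n) δ := by
    intro n h1 h2 z hz
    have h3 := (convex_ball (p 0) ρ).norm_image_sub_le_of_norm_deriv_le
      (fun w hw => h1.differentiableAt (hU.mem_nhds hw)) h2 hp0 hz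
    rw [hZp] at h3
    have h4 : 2 * (c * β ^ n) * ‖z - p 0‖ < 2 * (c * β ^ n) * ρ :=
      mul_lt_mul_of_pos_left (hUρ z hz) (by positivity)
    refine ⟨by linarith, ?_⟩
    rw [Metric.mem_ball, dist_eq_norm]
    have h5 : 2 * (c * β ^ n) * ρ ≤ 2 * c * ρ := by
      have : β ^ n ≤ 1 := pow_le_one₀ hβ₀.le hβ₁.le
      calc 2 * (c * β ^ n) * ρ = 2 * c * ρ * β ^ n := by ring
        _ ≤ 2 * c * ρ := mul_le_of_le_one_right (by positivity) this
    have h6 : ρ * (2 * c) ≤ δ := (le_div_iff₀ (by positivity)).1 (min_le_left _ _)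
    linarith
  have main : ∀ n, DifferentiableOn ℂ (iterates g n) U ∧ ∀ z ∈ U,
      ‖deriv (iterates g n) z‖ ≤ ‖D n‖ * Real.exp (A * ∑ j ∈ Finset.range n, β ^ j) := by
    intro n
    induction n with
    | zero => exact ⟨differentiableOn_id, fun z _ => by simp [iterates, hD₀]⟩
    | succ n ih =>
      obtain ⟨h1, h2⟩ := ih
      have h3 := dist_of n h1 fun z hz => (h2 z hz).trans (by
        rw [mul_comm]
        exact mul_le_mul (hexp n) (hDc n) (norm_nonneg _) zero_le_two)
      refine ⟨(hg n).comp h1 fun z hz => (h3 z hz).2, fun z hz => ?_⟩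
      obtain ⟨h4, h5⟩ := h3 z hz
      have h6 : deriv (iterates g (n + 1)) z =
          deriv (g n) (iterates g n z) * deriv (iterates g n) z :=
        deriv_comp z ((hg n).differentiableAt (Metric.isOpen_ball.mem_nhds h5))
          (h1.differentiableAt (hU.mem_nhds hz))
      have h7 : ‖deriv (g n) (iterates g n z)‖ ≤ ‖d n‖ * Real.exp (A * β ^ n) := by
        have h8 := hd n _ h5
        have h9 := norm_le_norm_add_norm_sub' (deriv (g n) (iterates g n z)) (d n)
        have h10 : K * ‖iterates g n z - p n‖ ≤ ‖d n‖ * (A * β ^ n) := by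
          calc K * ‖iterates g n z - p n‖ ≤ K * (2 * c * ρ * β ^ n) :=
                mul_le_mul_of_nonneg_left h4 hK
            _ = α * (A * β ^ n) := by rw [hA_def]; field_simp
            _ ≤ _ := mul_le_mul_of_nonneg_right (hdα n) (by positivity)
        have h11 := mul_le_mul_of_nonneg_left (Real.add_one_le_exp (A * β ^ n))
          (norm_nonneg (d n))
        linarith
      rw [h6, norm_mul, hD, norm_mul, Finset.sum_range_succ, mul_add, Real.exp_add]
      calc _ ≤ ‖d n‖ * Real.exp (A * β ^ n) *
            (‖D n‖ * Real.exp (A * ∑ j ∈ Finset.range n, β ^ j)) :=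
            mul_le_mul h7 (h2 z hz) (norm_nonneg _) (by positivity)
        _ = _ := by ring
  have hball := fun n => dist_of n (main n).1 fun z hz => ((main n).2 z hz).trans (by
        rw [mul_comm]
        exact mul_le_mul (hexp n) (hDc n) (norm_nonneg _) zero_le_two)
  set F : ℕ → ℂ → ℂ := fun n z => (iterates g n z - p n) / D n with hF_def
  have hF : ∀ n, DifferentiableOn ℂ (F n) U := fun n => ((main n).1.sub_const _).div_const _
  have hFderiv : ∀ n, ∀ z ∈ U, ‖deriv (fun z => F (n + 1) z - F n z) z‖ ≤ 2 * A * β ^ n := by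
    intro n z hz
    have hZ := (main n).1.differentiableAt (hU.mem_nhds hz)
    have hgd := (hg n).differentiableAt (Metric.isOpen_ball.mem_nhds (hball n z hz).2)
    have h1 : HasDerivAt (fun z => F (n + 1) z - F n z)
        (deriv (g n) (iterates g n z) * deriv (iterates g n) z / D (n + 1) -
          deriv (iterates g n) z / D n) z :=
      (((hgd.hasDerivAt.comp z hZ.hasDerivAt).sub_const _).div_const _).sub
        ((hZ.hasDerivAt.sub_const _).div_const _)
    have hdn : d n ≠ 0 := norm_pos_iff.1 (hα.trans_le (hdα n))
    have e : deriv (g n) (iterates g n z) * deriv (iterates g n) z / D (n + 1) -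
          deriv (iterates g n) z / D n =
        (deriv (g n) (iterates g n z) - d n) / d n * (deriv (iterates g n) z / D n) := by
      have := hDn n
      rw [hD]; field_simp
    rw [h1.deriv, e, norm_mul, norm_div, norm_div]
    have h2 : ‖deriv (g n) (iterates g n z) - d n‖ / ‖d n‖ ≤ A * β ^ n := by
      calc _ ≤ K * (2 * c * ρ * β ^ n) / α :=
            div_le_div₀ (by positivity) ((hd n _ (hball n z hz).2).trans
              (mul_le_mul_of_nonneg_left (hball n z hz).1 hK)) hα (hdα n)
        _ = A * β ^ n := by rw [hA_def]; ring
    have h3 : ‖deriv (iterates g n) z‖ / ‖D n‖ ≤ 2 := by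
      rw [div_le_iff₀ (norm_pos_iff.2 (hDn n)), mul_comm]
      exact ((main n).2 z hz).trans (mul_le_mul_of_nonneg_left (hexp n) (norm_nonneg _))
    calc _ ≤ A * β ^ n * 2 := mul_le_mul h2 h3 (by positivity) (by positivity)
      _ = _ := by ring
  have hFsub : ∀ n, ∀ z ∈ U, ‖F (n + 1) z - F n z‖ ≤ 2 * A * ρ * β ^ n := by
    intro n z hz
    have h1 := (convex_ball (p 0) ρ).norm_image_sub_le_of_norm_deriv_le
      (fun w hw => ((hF (n + 1)).sub (hF n)).differentiableAt (hU.mem_nhds hw))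
      (hFderiv n) hp0 hz
    have h2 : ∀ m, F m (p 0) = 0 := fun m => by simp [hF_def, hZp]
    have h4 : (F (n + 1) - F n) (p 0) = 0 := by rw [Pi.sub_apply, h2, h2, sub_zero]
    rw [h4, sub_zero, Pi.sub_apply] at h1
    have h5 := mul_le_mul_of_nonneg_left (hUρ z hz).le
      (show 0 ≤ 2 * A * β ^ n by positivity)
    linarith
  have hsumm := (summable_geometric_of_lt_one hβ₀.le hβ₁).mul_left (2 * A * ρ)
  refine ⟨ρ, hρ, fun z => F 0 z + ∑' n, (F (n + 1) z - F n z), ?_, fun z hz =>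
    ⟨fun n => (hball n z hz).2, ?_⟩⟩
  · exact (hF 0).add (Complex.differentiableOn_tsum_of_summable_norm hsumm
      (fun n => (hF (n + 1)).sub (hF n)) hU hFsub)
  · have h1 := (Summable.of_norm_bounded hsumm fun n => hFsub n z hz).hasSum.tendsto_sum_nat
    have h2 := h1.const_add (F 0 z)
    refine h2.congr fun n => ?_
    rw [Finset.sum_range_sub fun n => F n z]
    simp [hF_def]

namespace IsHyperbolic

variable {φ : Fin 2 → ℝ → ℝ}

lemma analyticWithinAt_linearizedLimit (hφ : IsHyperbolic .analytic φ) (y : Past) {x : ℝ}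
    (hx : x ∈ 𝕀) : AnalyticWithinAt ℝ (linearizedLimit φ y x) 𝕀 x := by
  obtain ⟨α, hα, hlow⟩ := hφ.deriv_lower
  obtain ⟨c, β, hc₀, hβ₀, hβ₁, hc⟩ := hφ.deriv_upper
  choose δ' K' hδ' hK' hG' using fun i => exists_uniform_holomorphic_extension (hφ.isOfClass i)
  choose! G hG1 hG2 hG3 using hG'
  obtain ⟨δ, hδ, hδle⟩ : ∃ δ, 0 < δ ∧ ∀ i, δ ≤ δ' i :=
    ⟨min (δ' 0) (δ' 1), lt_min (hδ' 0) (hδ' 1), fun i => by fin_cases i <;> simp⟩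
  obtain ⟨K, hK, hKle⟩ : ∃ K, 0 ≤ K ∧ ∀ i, K' i ≤ K :=
    ⟨max (K' 0) (K' 1), le_max_of_le_left (hK' 0), fun i => by fin_cases i <;> simp⟩
  set w := pastWord y with hw
  set P : ℕ → ℝ := fun n => wordMap φ (w n) x with hP
  have hPI : ∀ n, P n ∈ 𝕀 := fun n => hφ.mapsTo_wordMap _ hx
  set g : ℕ → ℂ → ℂ := fun n => G (y n) (P n) with hg
  have hgball : ∀ n, Metric.ball (P n : ℂ) δ ⊆ Metric.ball (P n : ℂ) (δ' (y n)) := fun n =>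
    Metric.ball_subset_ball (hδle _)
  have hgreal : ∀ n, ∀ t ∈ 𝕀, |t - P n| < δ → g n t = φ (y n) t := fun n t ht h =>
    hG2 _ _ (hPI n) t ht (h.trans_le (hδle _))
  have hgp : ∀ n, g n (P n) = (P (n + 1) : ℂ) := fun n =>
    hgreal n _ (hPI n) (by simpa using hδ)
  have hgd : ∀ n, deriv (g n) (P n) = ((derivWithin (φ (y n)) 𝕀 (P n) : ℝ) : ℂ) := by
    intro n
    have h1 : HasDerivWithinAt (fun t : ℝ => g n t) (deriv (g n) (P n)) 𝕀 (P n) :=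
      (((hG1 (y n) (P n) (hPI n)).differentiableAt (Metric.ball_mem_nhds _
        (hδ' _))).hasDerivAt.comp_ofReal).hasDerivWithinAt
    have h2 := ((hφ.isOfClass (y n)).hasDerivWithinAt (hPI n)).ofReal_comp
    refine (uniqueDiffOn_unit _ (hPI n)).eq_deriv _ h1 (h2.congr_of_eventuallyEq ?_ (hgp n))
    have h3 : Metric.ball (P n) δ ∈ 𝓝[𝕀] (P n) :=
      mem_nhdsWithin_of_mem_nhds (Metric.ball_mem_nhds _ hδ)
    filter_upwards [h3, self_mem_nhdsWithin] with t ht ht'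
    exact hgreal n t ht' ht
  have hlen : ∀ n, (w n).length = n := length_pastWord y
  obtain ⟨ρ, hρ, N, hN, hNlim⟩ := exists_holomorphic_limit (g := g) (p := fun n => (P n : ℂ))
    (d := fun n => ((derivWithin (φ (y n)) 𝕀 (P n) : ℝ) : ℂ))
    (D := fun n => ((derivWithin (wordMap φ (w n)) 𝕀 x : ℝ) : ℂ)) hδ hK hα hc₀ hβ₀ hβ₁
    (fun n => (hG1 _ _ (hPI n)).mono (hgball n)) hgp
    (fun n z hz => by
      rw [← hgd]
      exact (hG3 _ _ (hPI n) z (hgball n hz)).trans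
        (mul_le_mul_of_nonneg_right (hKle _) (norm_nonneg _)))
    (fun n => by
      rw [Complex.norm_real]
      exact (hlow (y n) _ (hPI n)).le.trans (le_abs_self _))
    (by simp only [hw, pastWord, derivWithin_nil hx, Complex.ofReal_one])
    (fun n => by rw [← Complex.ofReal_mul, ← hφ.derivWithin_cons _ _ hx]; rfl)
    (fun n => by
      rw [Complex.norm_real, Real.norm_eq_abs, abs_of_pos (hφ.derivWithin_wordMap_pos _ hx)]
      simpa only [hlen] using (hc (w n) x hx).le)
  have hreal : ∀ t ∈ 𝕀, |t - x| < ρ → N t = linearizedLimit φ y x t := by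
    intro t ht htx
    have hmem : (t : ℂ) ∈ Metric.ball ((P 0 : ℝ) : ℂ) ρ := by
      rw [Metric.mem_ball, Complex.dist_eq, ← Complex.ofReal_sub, Complex.norm_real]
      exact htx
    obtain ⟨h1, h2⟩ := hNlim t hmem
    have h3 : ∀ n, iterates g n t = ((wordMap φ (w n) t : ℝ) : ℂ) := by
      intro n
      induction n with
      | zero => rfl
      | succ n ih =>
        have h4 := h1 n
        rw [ih, Metric.mem_ball, Complex.dist_eq, ← Complex.ofReal_sub, Complex.norm_real] at h4
        simp only [iterates, ih]
        exact hgreal n _ (hφ.mapsTo_wordMap _ ht) h4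
    have h5 := (Complex.continuous_ofReal.tendsto _).comp (hφ.tendsto_linearized y hx ht)
    refine tendsto_nhds_unique h2 (h5.congr fun n => ?_)
    rw [h3]
    simp [linearized, hP, hw]
  have hNan : AnalyticAt ℂ N (x : ℂ) :=
    hN.analyticAt (Metric.ball_mem_nhds (x : ℂ) hρ)
  refine analyticWithinAt_iff_exists_analyticAt.2 ⟨_, ?_, hNan.re_ofReal⟩
  rw [insert_eq_of_mem hx]
  have h3 : Metric.ball x ρ ∈ 𝓝[𝕀] x :=
    mem_nhdsWithin_of_mem_nhds (Metric.ball_mem_nhds _ hρ)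
  filter_upwards [h3, self_mem_nhdsWithin] with t ht ht'
  rw [hreal t ht' ht, Complex.ofReal_re]

lemma analyticOn_limitMap (hφ : IsHyperbolic .analytic φ) (y : Past) :
    AnalyticOn ℝ (limitMap φ y) 𝕀 := by
  intro x hx
  have h1 : AnalyticWithinAt ℝ (fun t => (linearizedLimit φ y x t - linearizedLimit φ y x 0) /
      (linearizedLimit φ y x 1 - linearizedLimit φ y x 0)) 𝕀 x := by
    simp only [div_eq_mul_inv]
    exact ((hφ.analyticWithinAt_linearizedLimit y hx).sub analyticWithinAt_const).mul
      analyticWithinAt_const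
  exact h1.congr (fun t ht => hφ.limitMap_eq y hx ht) (hφ.limitMap_eq y hx hx)

/-- The limit map is as smooth as the Cantor set. -/
theorem isOfClass_limitMap {r : Degree} (hφ : IsHyperbolic r φ) (y : Past) :
    IsOfClass r (limitMap φ y) := by
  cases r with
  | holder k γ hk hγ₀ hγ₁ =>
    obtain ⟨k, rfl⟩ := Nat.exists_eq_add_of_le' hk
    exact (isOfClass_holder_iff hk hγ₀ hγ₁).2 (hφ.exists_holderBound_limitMap hγ₀ hγ₁
      (fun i => (isOfClass_holder_iff hk hγ₀ hγ₁).1 (hφ.isOfClass i)) y)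
  | smooth =>
    exact isOfClass_smooth_iff.2 fun k => hφ.exists_holderBound_limitMap one_pos le_rfl
      (fun i => isOfClass_smooth_iff.1 (hφ.isOfClass i) k) y
  | analytic => exact hφ.analyticOn_limitMap y

end IsHyperbolic

/-! ### Diffeomorphisms, conjugacies and limit maps -/

/-- `Φ` is an increasing bijection of `[0,1]`, of class `C^r` together with its inverse `Ψ`. -/
structure IsDiffeo (r : Degree) (Φ Ψ : ℝ → ℝ) : Prop where
  mapsTo : MapsTo Φ 𝕀 𝕀
  mapsTo_inv : MapsTo Ψ 𝕀 𝕀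
  invOn : InvOn Ψ Φ 𝕀 𝕀
  strictMonoOn : StrictMonoOn Φ 𝕀
  isOfClass : IsOfClass r Φ
  isOfClass_inv : IsOfClass r Ψ

namespace IsDiffeo

variable {r : Degree} {Φ Ψ : ℝ → ℝ}

lemma symm (h : IsDiffeo r Φ Ψ) : IsDiffeo r Ψ Φ where
  mapsTo := h.mapsTo_inv
  mapsTo_inv := h.mapsTo
  invOn := h.invOn.symm
  strictMonoOn s hs t ht hst := by
    rw [← h.strictMonoOn.lt_iff_lt (h.mapsTo_inv hs) (h.mapsTo_inv ht), h.invOn.2 hs, h.invOn.2 ht]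
    exact hst
  isOfClass := h.isOfClass_inv
  isOfClass_inv := h.isOfClass

lemma image_eq (h : IsDiffeo r Φ Ψ) : Φ '' 𝕀 = 𝕀 :=
  (h.mapsTo.image_subset).antisymm fun t ht => ⟨Ψ t, h.mapsTo_inv ht, h.invOn.2 ht⟩

lemma map_zero (h : IsDiffeo r Φ Ψ) : Φ 0 = 0 := by
  refine le_antisymm ?_ (h.mapsTo zero_mem_unit).1
  have := h.strictMonoOn.monotoneOn zero_mem_unit (h.mapsTo_inv zero_mem_unit)
    (h.mapsTo_inv zero_mem_unit).1
  rwa [h.invOn.2 zero_mem_unit] at this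

lemma map_one (h : IsDiffeo r Φ Ψ) : Φ 1 = 1 := by
  refine le_antisymm (h.mapsTo one_mem_unit).2 ?_
  have := h.strictMonoOn.monotoneOn (h.mapsTo_inv one_mem_unit) one_mem_unit
    (h.mapsTo_inv one_mem_unit).2
  rwa [h.invOn.2 one_mem_unit] at this

lemma derivWithin_pos (h : IsDiffeo r Φ Ψ) {t : ℝ} (ht : t ∈ 𝕀) : 0 < derivWithin Φ 𝕀 t := by
  have h1 := (h.isOfClass_inv.hasDerivWithinAt (h.mapsTo ht)).comp t
    (h.isOfClass.hasDerivWithinAt ht) h.mapsTo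
  have h2 := (hasDerivWithinAt_id t 𝕀).congr (f₁ := Ψ ∘ Φ) (fun s hs => h.invOn.1 hs)
    (h.invOn.1 ht)
  have h3 := (uniqueDiffOn_unit t ht).eq_deriv _ h1 h2
  have h4 : 0 ≤ derivWithin Φ 𝕀 t := h.strictMonoOn.monotoneOn.derivWithin_nonneg
  refine h4.lt_of_ne fun h5 => ?_
  rw [← h5, mul_zero] at h3
  exact zero_ne_one h3

lemma exists_le_derivWithin (h : IsDiffeo r Φ Ψ) :
    ∃ a : ℝ, 0 < a ∧ ∀ t ∈ 𝕀, a ≤ derivWithin Φ 𝕀 t := by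
  obtain ⟨x, hx, hmin⟩ := isCompact_Icc.exists_isMinOn ⟨0, zero_mem_unit⟩
    h.isOfClass.continuousOn_derivWithin
  exact ⟨_, h.derivWithin_pos hx, fun t ht => hmin ht⟩

lemma exists_derivWithin_le (h : IsDiffeo r Φ Ψ) :
    ∃ K : ℝ, 0 < K ∧ ∀ t ∈ 𝕀, derivWithin Φ 𝕀 t ≤ K := by
  obtain ⟨x, hx, hmax⟩ := isCompact_Icc.exists_isMaxOn ⟨0, zero_mem_unit⟩
    h.isOfClass.continuousOn_derivWithin
  exact ⟨_, h.derivWithin_pos hx, fun t ht => hmax ht⟩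

end IsDiffeo

lemma map_wordMap {φ ψ : Fin 2 → ℝ → ℝ} {Φ : ℝ → ℝ} (hφ : ∀ w, MapsTo (wordMap φ w) 𝕀 𝕀)
    (h : ∀ i, ∀ t ∈ 𝕀, Φ (φ i t) = ψ i (Φ t)) (w : List (Fin 2)) {t : ℝ} (ht : t ∈ 𝕀) :
    Φ (wordMap φ w t) = wordMap ψ w (Φ t) := by
  induction w with
  | nil => rfl
  | cons i w ih => simp only [wordMap, Function.comp_apply, h i _ (hφ w ht), ih]

lemma interval_eq_image {φ ψ : Fin 2 → ℝ → ℝ} {Φ : ℝ → ℝ} (hφ : ∀ w, MapsTo (wordMap φ w) 𝕀 𝕀)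
    (hΦ : Φ '' 𝕀 = 𝕀) (h : ∀ i, ∀ t ∈ 𝕀, Φ (φ i t) = ψ i (Φ t)) (w : List (Fin 2)) :
    interval ψ w = Φ '' interval φ w := by
  rw [interval, interval, image_image]
  conv_lhs => rw [← hΦ]
  rw [image_image]
  exact image_congr fun t ht => (map_wordMap hφ h w ht).symm

namespace IsHyperbolic

variable {r : Degree} {φ : Fin 2 → ℝ → ℝ}

/-- A hyperbolic Cantor set transported by a diffeomorphism of class `C^r`. -/
lemma conj (hφ : IsHyperbolic r φ) {Φ Ψ : ℝ → ℝ} (h : IsDiffeo r Φ Ψ) :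
    IsHyperbolic r (fun i t => Φ (φ i (Ψ t))) := by
  have hw : ∀ w, ∀ t ∈ 𝕀, wordMap (fun i t => Φ (φ i (Ψ t))) w t = Φ (wordMap φ w (Ψ t)) := by
    intro w t ht
    have h1 := map_wordMap (Φ := Φ) (ψ := fun i t => Φ (φ i (Ψ t))) hφ.mapsTo_wordMap
      (fun i t ht => by simp only [h.invOn.1 ht]) w (h.mapsTo_inv ht)
    rw [h1, h.invOn.2 ht]
  have hmaps : ∀ w, MapsTo (fun t => wordMap φ w (Ψ t)) 𝕀 𝕀 := fun w t ht =>
    hφ.mapsTo_wordMap w (h.mapsTo_inv ht)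
  have hd : ∀ w, ∀ t ∈ 𝕀, derivWithin (wordMap (fun i t => Φ (φ i (Ψ t))) w) 𝕀 t =
      derivWithin Φ 𝕀 (wordMap φ w (Ψ t)) *
        (derivWithin (wordMap φ w) 𝕀 (Ψ t) * derivWithin Ψ 𝕀 t) := by
    intro w t ht
    have h1 := (hφ.hasDerivWithinAt_wordMap w (h.mapsTo_inv ht)).comp t
      (h.isOfClass_inv.hasDerivWithinAt ht) h.mapsTo_inv
    have h2 := (h.isOfClass.hasDerivWithinAt (hmaps w ht)).comp t h1 (hmaps w)
    exact (h2.congr (hw w) (hw w t ht)).derivWithin (uniqueDiffOn_unit t ht)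
  have h0 := h.map_zero
  have h1 := h.map_one
  have j0 := h.symm.map_zero
  have j1 := h.symm.map_one
  refine ⟨fun i t ht => h.mapsTo (hφ.mapsTo i (h.mapsTo_inv ht)), fun i => ?_, ?_, ?_, ?_, ?_, ?_⟩
  · exact h.isOfClass.comp ((hφ.isOfClass i).comp h.isOfClass_inv h.mapsTo_inv)
      fun t ht => hφ.mapsTo i (h.mapsTo_inv ht)
  · simp only [j0, hφ.left_end, h0]
  · simp only [j1, hφ.right_end, h1]
  · simp only [j0, j1]
    exact h.strictMonoOn (hφ.mapsTo 0 one_mem_unit) (hφ.mapsTo 1 zero_mem_unit) hφ.gap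
  · obtain ⟨α, hα, hlow⟩ := hφ.deriv_lower
    obtain ⟨a, ha, hΦ⟩ := h.exists_le_derivWithin
    obtain ⟨b, hb, hΨ⟩ := h.symm.exists_le_derivWithin
    refine ⟨a * (α * b), by positivity, fun i t ht => ?_⟩
    have h2 := hd [i] t ht
    have h3 : ∀ θ : Fin 2 → ℝ → ℝ, wordMap θ [i] = θ i := fun θ => rfl
    rw [h3, h3] at h2
    rw [h2]
    have h4 := hlow i _ (h.mapsTo_inv ht)
    have h5 := hΦ _ (hφ.mapsTo i (h.mapsTo_inv ht))
    calc a * (α * b) < a * (derivWithin (φ i) 𝕀 (Ψ t) * b) := by gcongr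
      _ ≤ _ := by
        have := hΨ t ht
        have := hα.trans h4
        have := ha.trans_le h5
        gcongr
  · obtain ⟨c, β, hc₀, hβ₀, hβ₁, hc⟩ := hφ.deriv_upper
    obtain ⟨a, ha, hΦ⟩ := h.exists_derivWithin_le
    obtain ⟨b, hb, hΨ⟩ := h.symm.exists_derivWithin_le
    refine ⟨a * c * b, β, by positivity, hβ₀, hβ₁, fun w t ht => ?_⟩
    rw [hd w t ht]
    have h2 := hc w _ (h.mapsTo_inv ht)
    have h3 := hΦ _ (hmaps w ht)
    have h4 := hΨ t ht
    have h5 := h.symm.derivWithin_pos ht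
    have h6 := hφ.derivWithin_wordMap_pos w (h.mapsTo_inv ht)
    calc _ ≤ a * (derivWithin (wordMap φ w) 𝕀 (Ψ t) * b) := by gcongr
      _ < a * (c * β ^ w.length * b) := by gcongr
      _ = _ := by ring

/-- The limit map is a diffeomorphism of class `C^r`. -/
lemma exists_isDiffeo_limitMap (hφ : IsHyperbolic r φ) (y : Past) :
    ∃ Ψ, IsDiffeo r (limitMap φ y) Ψ := by
  have hcl := hφ.isOfClass_limitMap y
  have hmono := hφ.strictMonoOn_limitMap y
  have hcont : ContinuousOn (limitMap φ y) 𝕀 := hcl.differentiableOn.continuousOn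
  have hmaps : MapsTo (limitMap φ y) 𝕀 𝕀 := fun t ht => by
    have h1 := hmono.monotoneOn zero_mem_unit ht ht.1
    have h2 := hmono.monotoneOn ht one_mem_unit ht.2
    rw [hφ.limitMap_zero] at h1
    rw [hφ.limitMap_one] at h2
    exact ⟨h1, h2⟩
  have hsurj : SurjOn (limitMap φ y) 𝕀 𝕀 := by
    have := intermediate_value_Icc zero_le_one hcont
    rwa [hφ.limitMap_zero, hφ.limitMap_one] at this
  have hinv : InvOn (Function.invFunOn (limitMap φ y) 𝕀) (limitMap φ y) 𝕀 𝕀 :=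
    BijOn.invOn_invFunOn ⟨hmaps, hmono.injOn, hsurj⟩
  have hmaps' : MapsTo (Function.invFunOn (limitMap φ y) 𝕀) 𝕀 𝕀 := hsurj.mapsTo_invFunOn
  obtain ⟨a, ha, h⟩ := hφ.exists_mul_sub_le_limitMap y
  have hlow : ∀ t ∈ 𝕀, a ≤ derivWithin (limitMap φ y) 𝕀 t := by
    intro t ht
    have hd : HasDerivWithinAt (fun t => limitMap φ y t - a * t)
        (derivWithin (limitMap φ y) 𝕀 t - a * 1) 𝕀 t :=
      (hcl.hasDerivWithinAt ht).sub ((hasDerivWithinAt_id t 𝕀).const_mul a)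
    have hm : MonotoneOn (fun t => limitMap φ y t - a * t) 𝕀 := fun s hs t ht hst => by
      have := h s hs t ht hst
      simp only
      linarith
    have h0 := hm.derivWithin_nonneg (x := t)
    rw [hd.derivWithin (uniqueDiffOn_unit t ht)] at h0
    linarith
  exact ⟨_, hmaps, hmaps', hinv, hmono, hcl, hcl.inverse ha hlow hmaps' hinv.2⟩

/-- A conjugacy is asymptotically affine on the small intervals `I_w`, so the limit maps of
conjugate Cantor sets differ by the conjugacy. -/
lemma limitMap_comp (hφ : IsHyperbolic r φ) {r' r'' : Degree} {ψ : Fin 2 → ℝ → ℝ}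
    (hψ : IsHyperbolic r' ψ) {Φ Ψ : ℝ → ℝ} (hΦ : IsDiffeo r'' Φ Ψ)
    (h : ∀ i, ∀ t ∈ 𝕀, Φ (φ i t) = ψ i (Φ t)) (y : Past) {t : ℝ} (ht : t ∈ 𝕀) :
    limitMap ψ y (Φ t) = limitMap φ y t := by
  rcases ht.1.eq_or_lt with rfl | ht0
  · rw [hΦ.map_zero, hφ.limitMap_zero, hψ.limitMap_zero]
  obtain ⟨c, β, hc₀, hβ₀, hβ₁, hc⟩ := hφ.deriv_upper
  obtain ⟨a, ha, hlow⟩ := hΦ.exists_le_derivWithin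
  set w := pastWord y
  have mvt : ∀ s ∈ 𝕀, 0 < s → ∀ n, ∃ ξ ∈ 𝕀, |ξ - wordMap φ (w n) 0| ≤ c * β ^ n ∧
      Φ (wordMap φ (w n) s) - Φ (wordMap φ (w n) 0) =
        derivWithin Φ 𝕀 ξ * (wordMap φ (w n) s - wordMap φ (w n) 0) := by
    intro s hs hs0 n
    have hlt := hφ.strictMonoOn_wordMap (w n) zero_mem_unit hs hs0
    have hA := hφ.mapsTo_wordMap (w n) zero_mem_unit
    have hB := hφ.mapsTo_wordMap (w n) hs
    have hsub : Icc (wordMap φ (w n) 0) (wordMap φ (w n) s) ⊆ 𝕀 := Icc_subset_Icc hA.1 hB.2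
    obtain ⟨ξ, hξ, hslope⟩ := exists_hasDerivAt_eq_slope Φ (derivWithin Φ 𝕀) hlt
      (hΦ.isOfClass.differentiableOn.continuousOn.mono hsub) fun x hx =>
        (hΦ.isOfClass.hasDerivWithinAt (hsub (Ioo_subset_Icc_self hx))).hasDerivAt
          (Icc_mem_nhds (hA.1.trans_lt hx.1) (hx.2.trans_le hB.2))
    refine ⟨ξ, hsub (Ioo_subset_Icc_self hξ), ?_, ?_⟩
    · have h1 := hφ.abs_wordMap_sub_le hc (w n) hs zero_mem_unit
      rw [length_pastWord, abs_of_pos (sub_pos.2 hlt), sub_zero, abs_of_pos hs0] at h1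
      rw [abs_of_pos (sub_pos.2 hξ.1)]
      have h2 : c * β ^ n * s ≤ c * β ^ n := mul_le_of_le_one_right (by positivity) hs.2
      linarith [hξ.2]
    · rw [hslope, div_mul_cancel₀ _ (sub_pos.2 hlt).ne']
  choose ξ hξI hξ hξeq using mvt t ht ht0
  choose η hηI hη hηeq using mvt 1 one_mem_unit one_pos
  have hratio : Tendsto (fun n => derivWithin Φ 𝕀 (ξ n) / derivWithin Φ 𝕀 (η n)) atTop (𝓝 1) := by
    obtain ⟨K, -, f', hf', h1⟩ := hΦ.isOfClass.exists_holderBound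
    have hDf : ∀ t ∈ 𝕀, derivWithin Φ 𝕀 t = f' t := fun t ht =>
      (hf' t ht).derivWithin (uniqueDiffOn_unit t ht)
    have hK : 0 ≤ K := h1.nonneg
    have hb : ∀ n, ‖derivWithin Φ 𝕀 (ξ n) / derivWithin Φ 𝕀 (η n) - 1‖ ≤
        K * (2 * c * β ^ n) ^ r''.exponent / a := by
      intro n
      have h2 := hlow _ (hηI n)
      have h3 : 0 < derivWithin Φ 𝕀 (η n) := ha.trans_le h2
      rw [div_sub_one h3.ne', norm_div, Real.norm_eq_abs, Real.norm_eq_abs, abs_of_pos h3]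
      refine div_le_div₀ (by positivity) ?_ ha h2
      rw [hDf _ (hξI n), hDf _ (hηI n)]
      refine (h1.2 _ (hξI n) _ (hηI n)).trans ?_
      have h4 : |ξ n - η n| ≤ 2 * c * β ^ n := by
        have h5 := abs_sub_le (ξ n) (wordMap φ (w n) 0) (η n)
        rw [abs_sub_comm (wordMap φ (w n) 0)] at h5
        linarith [hξ n, hη n]
      exact mul_le_mul_of_nonneg_left (Real.rpow_le_rpow (abs_nonneg _) h4
        r''.exponent_pos.le) hK
    rw [tendsto_iff_norm_sub_tendsto_zero]
    refine squeeze_zero (fun _ => norm_nonneg _) hb ?_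
    have h5 : Tendsto (fun n => 2 * c * β ^ n) atTop (𝓝 0) := by
      simpa using (tendsto_pow_atTop_nhds_zero_of_lt_one hβ₀.le hβ₁).const_mul (2 * c)
    have h6 := h5.rpow_const (p := r''.exponent) (Or.inr r''.exponent_pos.le)
    rw [Real.zero_rpow r''.exponent_pos.ne'] at h6
    simpa using (h6.const_mul K).div_const a
  refine tendsto_nhds_unique (hψ.tendsto_normalized y (hΦ.mapsTo ht)) ?_
  have h7 := hratio.mul (hφ.tendsto_normalized y ht)
  rw [one_mul] at h7
  refine h7.congr fun n => ?_
  have e := fun {s} (hs : s ∈ 𝕀) => map_wordMap hφ.mapsTo_wordMap h (w n) hs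
  have e0 := e zero_mem_unit
  have e1 := e one_mem_unit
  rw [hΦ.map_zero] at e0
  rw [hΦ.map_one] at e1
  rw [normalized, normalized, ← e ht, ← e0, ← e1, hξeq, hηeq, div_mul_div_comm]

end IsHyperbolic

/-! ### Scaling function and limit sets -/

lemma length_word (x : ℕ → Fin 2) (n : ℕ) : (word x n).length = n := by simp [word]

lemma word_succ (x : ℕ → Fin 2) (n : ℕ) : word x (n + 1) = word x n ++ [x n] := by
  simp [word, List.range_succ]

lemma exists_word_eq (v : List (Fin 2)) : ∃ x, word x v.length = v := by
  refine ⟨fun n => v.getD n 0, List.ext_getElem (by simp [word]) fun n h1 h2 => ?_⟩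
  simp [word, h2]

/-- Membership in the Cantor set in terms of finite words. -/
lemma mem_cantorSet_iff {φ : Fin 2 → ℝ → ℝ} {p : ℝ} :
    p ∈ cantorSet φ ↔ ∀ n, ∃ v : List (Fin 2), v.length = n ∧ p ∈ interval φ v := by
  simp only [cantorSet, mem_iInter, mem_iUnion]
  refine forall_congr' fun n => ⟨fun ⟨x, hx⟩ => ⟨_, length_word x n, hx⟩, ?_⟩
  rintro ⟨v, rfl, hv⟩
  obtain ⟨x, hx⟩ := exists_word_eq v
  exact ⟨x, by rwa [hx]⟩

lemma pastWord_cons (a : Fin 2) (z : Past) (m : ℕ) :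
    pastWord (fun n => Nat.casesOn n a z) (m + 1) = pastWord z m ++ [a] := by
  induction m with
  | zero => rfl
  | succ m ih => rw [pastWord, ih]; rfl

lemma pastWord_extendPast (y : Past) (x : ℕ → Fin 2) (n m : ℕ) :
    pastWord (extendPast y x n) (m + n) = pastWord y m ++ word x n := by
  induction n with
  | zero => simp [extendPast, word]
  | succ n ih =>
    rw [word_succ, ← List.append_assoc, ← ih, ← add_assoc]
    exact pastWord_cons (x n) (extendPast y x n) (m + n)

/-- The scaling function: the limit map at `y` sends the first subdivision of `[0,1]` to the limit
of the ratio geometries. -/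
noncomputable def scalingFunction (φ : Fin 2 → ℝ → ℝ) (y : Past) : ℝ × ℝ × ℝ :=
  (limitMap φ y (φ 0 1), limitMap φ y (φ 1 0) - limitMap φ y (φ 0 1), 1 - limitMap φ y (φ 1 0))

namespace IsHyperbolic

variable {r : Degree} {φ : Fin 2 → ℝ → ℝ}

lemma isScalingFunction (hφ : IsHyperbolic r φ) :
    IsScalingFunction φ (scalingFunction φ) := by
  intro y
  have h1 := hφ.tendsto_normalized y (hφ.mapsTo 0 one_mem_unit)
  have h2 := hφ.tendsto_normalized y (hφ.mapsTo 1 zero_mem_unit)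
  refine (h1.prodMk_nhds ((h2.sub h1).prodMk_nhds (h2.const_sub 1))).congr fun n => ?_
  have h3 := (sub_pos.2 (hφ.wordMap_zero_lt_one (pastWord y n))).ne'
  have e : ∀ i t, wordMap φ [i] t = φ i t := fun i t => rfl
  simp only [ratioGeometry, normalized, wordMap_append, e, hφ.left_end, hφ.right_end,
    ← sub_div, sub_sub_sub_cancel_right, Prod.mk.injEq, true_and]
  rw [eq_div_iff h3, sub_mul, div_mul_cancel₀ _ h3]
  ring

/-- The limit map at the past `… y₋₁ x₀ … x_{n-1}` is the limit map at `y`, restricted to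
`I_{x₀ … x_{n-1}}` and rescaled. -/
lemma limitMap_extendPast (hφ : IsHyperbolic r φ) (y : Past) (x : ℕ → Fin 2) (n : ℕ) {t : ℝ}
    (ht : t ∈ 𝕀) : limitMap φ (extendPast y x n) t =
      (limitMap φ y (wordMap φ (word x n) t) - limitMap φ y (wordMap φ (word x n) 0)) /
      (limitMap φ y (wordMap φ (word x n) 1) - limitMap φ y (wordMap φ (word x n) 0)) := by
  have hm := hφ.mapsTo_wordMap (word x n)
  have h1 := (tendsto_add_atTop_iff_nat n).2 (hφ.tendsto_normalized (extendPast y x n) ht)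
  refine tendsto_nhds_unique h1 ?_
  have hpos : limitMap φ y (wordMap φ (word x n) 1) - limitMap φ y (wordMap φ (word x n) 0) ≠ 0 :=
    (sub_pos.2 (hφ.strictMonoOn_limitMap y (hm zero_mem_unit) (hm one_mem_unit)
      (hφ.wordMap_zero_lt_one _))).ne'
  have h2 := hφ.tendsto_normalized y (hm zero_mem_unit)
  refine (((hφ.tendsto_normalized y (hm ht)).sub h2).div
    ((hφ.tendsto_normalized y (hm one_mem_unit)).sub h2) hpos).congr fun m => ?_
  have h3 := (sub_pos.2 (hφ.wordMap_zero_lt_one (pastWord y m))).ne'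
  rw [pastWord_extendPast]
  simp only [normalized, wordMap_append, ← sub_div, sub_sub_sub_cancel_right, Pi.div_apply]
  rw [div_div_div_cancel_right₀ h3]

lemma ratioEndpoints_eq (hφ : IsHyperbolic r φ) (y : Past) (x : ℕ → Fin 2) (n : ℕ) :
    ratioEndpoints (scalingFunction φ) y x n =
      (limitMap φ y (wordMap φ (word x n) 0), limitMap φ y (wordMap φ (word x n) 1)) := by
  induction n with
  | zero => simp [ratioEndpoints, word, wordMap, hφ.limitMap_zero, hφ.limitMap_one]
  | succ n ih =>
    have hm := hφ.mapsTo_wordMap (word x n)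
    have hpos : limitMap φ y (wordMap φ (word x n) 1) -
        limitMap φ y (wordMap φ (word x n) 0) ≠ 0 :=
      (sub_pos.2 (hφ.strictMonoOn_limitMap y (hm zero_mem_unit) (hm one_mem_unit)
        (hφ.wordMap_zero_lt_one _))).ne'
    have e : ∀ i t, wordMap φ [i] t = φ i t := fun i t => rfl
    simp only [ratioEndpoints, ih, scalingFunction,
      hφ.limitMap_extendPast y x n (hφ.mapsTo 0 one_mem_unit),
      hφ.limitMap_extendPast y x n (hφ.mapsTo 1 zero_mem_unit), word_succ, wordMap_append, e]
    by_cases hx : x n = 0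
    · simp only [hx, if_true, hφ.left_end, div_mul_cancel₀ _ hpos, add_sub_cancel]
    · have hx1 : x n = 1 := by omega
      simp only [hx1, one_ne_zero, if_false, hφ.right_end, sub_mul, one_mul,
        div_mul_cancel₀ _ hpos, Prod.mk.injEq, and_true]
      ring

lemma ratioInterval_eq (hφ : IsHyperbolic r φ) (y : Past) (x : ℕ → Fin 2) (n : ℕ) :
    ratioInterval (scalingFunction φ) y x n = limitMap φ y '' interval φ (word x n) := by
  have hm := hφ.mapsTo_wordMap (word x n)
  have hmono : MonotoneOn (fun t => limitMap φ y (wordMap φ (word x n) t)) 𝕀 := fun s hs t ht hst =>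
    (hφ.strictMonoOn_limitMap y).monotoneOn (hm hs) (hm ht)
      ((hφ.strictMonoOn_wordMap _).monotoneOn hs ht hst)
  have hcont : ContinuousOn (fun t => limitMap φ y (wordMap φ (word x n) t)) 𝕀 :=
    (hφ.isOfClass_limitMap y).differentiableOn.continuousOn.comp
      (fun t ht => (hφ.hasDerivWithinAt_wordMap _ ht).continuousWithinAt) hm
  rw [ratioInterval, hφ.ratioEndpoints_eq, interval, image_image]
  refine (intermediate_value_Icc zero_le_one hcont).antisymm ?_
  rintro _ ⟨t, ht, rfl⟩
  exact ⟨hmono zero_mem_unit ht ht.1, hmono ht one_mem_unit ht.2⟩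

lemma interval_subset (hφ : IsHyperbolic r φ) (w : List (Fin 2)) : interval φ w ⊆ 𝕀 :=
  (hφ.mapsTo_wordMap w).image_subset

lemma interval_append_subset (hφ : IsHyperbolic r φ) (v w : List (Fin 2)) :
    interval φ (v ++ w) ⊆ interval φ v := by
  rintro _ ⟨t, ht, rfl⟩
  exact ⟨_, hφ.mapsTo_wordMap w ht, (wordMap_append φ v w t).symm⟩

lemma ratioCantorSet_eq (hφ : IsHyperbolic r φ) (y : Past) :
    ratioCantorSet (scalingFunction φ) y = limitMap φ y '' cantorSet φ := by
  simp only [ratioCantorSet, cantorSet, hφ.ratioInterval_eq, ← image_iUnion]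
  refine (InjOn.image_iInter_eq ((hφ.strictMonoOn_limitMap y).injOn.mono ?_)).symm
  exact iUnion_subset fun n => iUnion_subset fun x => hφ.interval_subset _

/-- Intervals `I_v`, `I_w` of the same generation are disjoint unless `v = w`. -/
lemma eq_of_wordMap_eq (hφ : IsHyperbolic r φ) {v w : List (Fin 2)} (hl : v.length = w.length)
    {s t : ℝ} (hs : s ∈ 𝕀) (ht : t ∈ 𝕀) (h : wordMap φ v s = wordMap φ w t) : v = w := by
  induction v generalizing w with
  | nil => exact (List.length_eq_zero_iff.1 hl.symm).symm
  | cons i v ih =>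
    cases w with
    | nil => simp at hl
    | cons j w =>
      simp only [List.length_cons, Nat.add_right_cancel_iff] at hl
      have h' : φ i (wordMap φ v s) = φ j (wordMap φ w t) := h
      have hv := hφ.mapsTo_wordMap v hs
      have hw := hφ.mapsTo_wordMap w ht
      have sep : ∀ a ∈ 𝕀, ∀ b ∈ 𝕀, φ 0 a < φ 1 b := fun a ha b hb =>
        ((hφ.strictMonoOn_branch 0).monotoneOn ha one_mem_unit ha.2).trans_lt
          (hφ.gap.trans_le ((hφ.strictMonoOn_branch 1).monotoneOn zero_mem_unit hb hb.1))
      have hij : i = j := by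
        fin_cases i <;> fin_cases j
        · rfl
        · exact absurd h' (sep _ hv _ hw).ne
        · exact absurd h' (sep _ hw _ hv).ne'
        · rfl
      subst hij
      rw [ih hl ((hφ.strictMonoOn_branch i).injOn hv hw h')]

lemma cantorSet_subset (hφ : IsHyperbolic r φ) : cantorSet φ ⊆ 𝕀 := fun p hp => by
  obtain ⟨v, -, hv⟩ := mem_cantorSet_iff.1 hp 0
  exact hφ.interval_subset v hv

/-- The Cantor set is self-similar: its part in `I_w` is its image under `φ_w`. -/
lemma cantorSet_inter_interval (hφ : IsHyperbolic r φ) (w : List (Fin 2)) :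
    cantorSet φ ∩ interval φ w = wordMap φ w '' cantorSet φ := by
  ext p
  constructor
  · rintro ⟨hp, q, hq, rfl⟩
    refine ⟨q, mem_cantorSet_iff.2 fun n => ?_, rfl⟩
    obtain ⟨v, hv, hpv⟩ := mem_cantorSet_iff.1 hp (w.length + n)
    have hsplit := List.take_append_drop w.length v
    obtain ⟨s, hs, hsp⟩ := hpv
    rw [← hsplit, wordMap_append] at hsp
    have hs' := hφ.mapsTo_wordMap (v.drop w.length) hs
    have htake : v.take w.length = w :=
      hφ.eq_of_wordMap_eq (by rw [List.length_take]; omega) hs' hq hsp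
    rw [htake] at hsp
    exact ⟨v.drop w.length, by rw [List.length_drop]; omega, s, hs,
      (hφ.strictMonoOn_wordMap w).injOn hs' hq hsp⟩
  · rintro ⟨q, hq, rfl⟩
    refine ⟨mem_cantorSet_iff.2 fun n => ?_, q, hφ.cantorSet_subset hq, rfl⟩
    obtain ⟨v, hv, s, hs, rfl⟩ := mem_cantorSet_iff.1 hq n
    refine ⟨(w ++ v).take n, by rw [List.length_take, List.length_append]; omega, ?_⟩
    rw [← wordMap_append]
    refine hφ.interval_append_subset _ ((w ++ v).drop n) ?_
    rw [List.take_append_drop]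
    exact ⟨s, hs, rfl⟩

lemma rescaledPiece_eq (hφ : IsHyperbolic r φ) (w : List (Fin 2)) :
    rescaledPiece φ w = normalized φ w '' cantorSet φ := by
  rw [rescaledPiece, hφ.cantorSet_inter_interval, image_image]
  rfl

lemma tendsto_hausdorffEDist (hφ : IsHyperbolic r φ) (y : Past) :
    Tendsto (fun n => Metric.hausdorffEDist (rescaledPiece φ (pastWord y n))
      (ratioCantorSet (scalingFunction φ) y)) atTop (𝓝 0) := by
  obtain ⟨Q, b, hb₀, hb₁, h⟩ := hφ.exists_normalized_sub_limitMap_le y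
  have h1 : Tendsto (fun n => ENNReal.ofReal (Q * b ^ n)) atTop (𝓝 0) := by
    have h2 := (tendsto_pow_atTop_nhds_zero_of_lt_one hb₀ hb₁).const_mul Q
    rw [mul_zero] at h2
    simpa using ENNReal.tendsto_ofReal h2
  refine tendsto_of_tendsto_of_tendsto_of_le_of_le tendsto_const_nhds h1
    (fun _ => zero_le) fun n => ?_
  have hd : ∀ t ∈ cantorSet φ,
      edist (normalized φ (pastWord y n) t) (limitMap φ y t) ≤ ENNReal.ofReal (Q * b ^ n) :=
    fun t ht => by
      rw [edist_dist, Real.dist_eq]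
      exact ENNReal.ofReal_le_ofReal (h t (hφ.cantorSet_subset ht) n)
  rw [hφ.rescaledPiece_eq, hφ.ratioCantorSet_eq]
  refine Metric.hausdorffEDist_le_of_mem_edist ?_ ?_
  · rintro _ ⟨t, ht, rfl⟩
    exact ⟨_, ⟨t, ht, rfl⟩, hd t ht⟩
  · rintro _ ⟨t, ht, rfl⟩
    exact ⟨_, ⟨t, ht, rfl⟩, by rw [edist_comm]; exact hd t ht⟩

/-- A system into which the limit map carries `φ` has the limit set as its marked Cantor set. -/
lemma hasMarkedSet_of_conj (hφ : IsHyperbolic r φ) (y : Past) {θ : Fin 2 → ℝ → ℝ} {Ψ : ℝ → ℝ}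
    (hg : IsDiffeo r (limitMap φ y) Ψ)
    (h : ∀ i, ∀ t ∈ 𝕀, limitMap φ y (φ i t) = θ i (limitMap φ y t)) :
    HasMarkedSet θ (scalingFunction φ) y := by
  have e : ∀ (x : ℕ → Fin 2) (n : ℕ),
      interval θ (word x n) = ratioInterval (scalingFunction φ) y x n := fun x n => by
    rw [interval_eq_image hφ.mapsTo_wordMap hg.image_eq h, hφ.ratioInterval_eq]
  exact ⟨by simp only [cantorSet, ratioCantorSet, e], fun x p => by simp only [e]⟩

end IsHyperbolic

end HyperbolicCantor

theorem theorem7p4 (γ : ℝ) (hγ₀ : 0 < γ) (hγ₁ : γ ≤ 1) (φ : Fin 2 → ℝ → ℝ)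
    (hφ : HyperbolicCantor.IsHyperbolic (.holder 1 γ le_rfl hγ₀ hγ₁) φ) :
    ∃ R : HyperbolicCantor.Past → ℝ × ℝ × ℝ,
      HyperbolicCantor.IsScalingFunction φ R ∧
      ∀ y : HyperbolicCantor.Past,
        Tendsto (fun n : ℕ => Metric.hausdorffEDist
            (HyperbolicCantor.rescaledPiece φ (HyperbolicCantor.pastWord y n))
            (HyperbolicCantor.ratioCantorSet R y)) atTop (𝓝 0) ∧
        ∀ (r : HyperbolicCantor.Degree) (ψ : Fin 2 → ℝ → ℝ),
          HyperbolicCantor.IsHyperbolic r ψ →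
          HyperbolicCantor.IsConjugate (.holder 1 γ le_rfl hγ₀ hγ₁) φ ψ →
          ∃ θ : Fin 2 → ℝ → ℝ,
            HyperbolicCantor.IsHyperbolic r θ ∧
            HyperbolicCantor.HasMarkedSet θ R y ∧
            HyperbolicCantor.IsConjugate (.holder 1 γ le_rfl hγ₀ hγ₁) φ θ ∧
            HyperbolicCantor.IsConjugate r ψ θ := by
  refine ⟨HyperbolicCantor.scalingFunction φ, hφ.isScalingFunction, fun y =>
    ⟨hφ.tendsto_hausdorffEDist y, ?_⟩⟩
  rintro r ψ hψ ⟨Φ, Ψ, hΦ, hΨ, hinv, hmono, hcΦ, hcΨ, hconj⟩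
  have hdiff : HyperbolicCantor.IsDiffeo _ Φ Ψ := ⟨hΦ, hΨ, hinv, hmono, hcΦ, hcΨ⟩
  obtain ⟨h', hh⟩ := hψ.exists_isDiffeo_limitMap y
  obtain ⟨g', hg⟩ := hφ.exists_isDiffeo_limitMap y
  have hcomp : ∀ t ∈ Icc (0 : ℝ) 1, HyperbolicCantor.limitMap ψ y (Φ t) =
      HyperbolicCantor.limitMap φ y t := fun t ht => hφ.limitMap_comp hψ hdiff hconj y ht
  -- the limit map of `φ` conjugates `φ` to the system obtained from `ψ` by its own limit map
  have hθ : ∀ i, ∀ t ∈ Icc (0 : ℝ) 1, HyperbolicCantor.limitMap φ y (φ i t) =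
      HyperbolicCantor.limitMap ψ y (ψ i (h' (HyperbolicCantor.limitMap φ y t))) := by
    intro i t ht
    rw [← hcomp _ (hφ.mapsTo i ht), ← hcomp t ht, hconj i t ht, hh.invOn.1 (hΦ ht)]
  refine ⟨fun i t => HyperbolicCantor.limitMap ψ y (ψ i (h' t)), hψ.conj hh,
    hφ.hasMarkedSet_of_conj y hg hθ, ?_, ?_⟩
  · exact ⟨_, g', hg.mapsTo, hg.mapsTo_inv, hg.invOn, hg.strictMonoOn, hg.isOfClass,
      hg.isOfClass_inv, hθ⟩
  · exact ⟨_, h', hh.mapsTo, hh.mapsTo_inv, hh.invOn, hh.strictMonoOn, hh.isOfClass,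
      hh.isOfClass_inv, fun i t ht => by simp only [hh.invOn.1 ht]⟩
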